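/- Let $\bar Y=(\bar Y_s)_{s\in\mathbb R}$ be a double-sided real Lévy process on a probability space (i.e. $\bar Y_0=0$ a.s., stationary and independent increments, a.s. càdlàg paths) with $\mathbb E[\ln^+|\bar Y_1|]<\infty$, let $\rho$ be the Lévy measure of $\bar Y_1$, and let $H>0$. Let $X=(X_t)_{t\ge 0}$ be the $H$-selfsimilar Sato process given, for every $t\ge 0$, a.s. by $$X_t=\int_{\ln(t^{-H})}^{\infty}e^{-s}\,d\bar Y_s\qquad (X_0=0),$$ where the integral over $(a,b]$ is evaluated pathwise by parts, $\int_a^b e^{-s}\,d\bar Y_s=e^{-b}\bar Y_b-e^{-a}\bar Y_a+\int_a^b e^{-s}\bar Y_s\,ds$, and $\int_a^\infty=\lim_{b\to\infty}\int_a^b$; these limits exist almost surely. A measure $\nu$ on $\mathbb R^{[0,\infty)}$ with its cylindrical $\sigma$-algebra is called the Lévy measure of $X$ if (i) for all finite $\{t_1,\dots,t_n\}\subset[0,\infty)$ the projection of $\nu$ onto $\mathbb R^{\{t_1,\dots,t_n\}}$, restricted to the complement of the origin, is the Lévy measure of the random vector $(X_{t_1},\dots,X_{t_n})$, and (ii)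 $\nu(A)=\sup\{\nu(B): B\text{ measurable},\ B\subseteq A\setminus\{0\}\}$ for every measurable $A$. Then $X$ has exactly one Lévy measure $\nu$, and for every measurable $F:\mathbb R^{[0,\infty)}\to[0,\infty]$ $$\int F\,d\nu=\int_{\mathbb R}\int_{\mathbb R}F\big(x e^{-s}\mathbf 1_{[e^{-s/H},\infty)}\big)\,\rho(dx)\,ds .$$ That is, $\nu$ is the image of $\mathrm{Leb}\otimes\rho$ under the map $(s,x)\mapsto x f_{\cdot}(s)$ from $\mathbb R^2$ to $\mathbb R^{[0,\infty)}$, where $f_t(s)=e^{-s}\mathbf 1_{[e^{-s/H},\infty)}(t)$. -/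

import Mathlib

open MeasureTheory ProbabilityTheory Filter Topology
open scoped ENNReal NNReal

noncomputable section

/-- `IsLevyMeasure μ ρ`: the measure `ρ` is the Lévy measure of the (infinitely divisible)
probability law `μ` on a Euclidean space, i.e. `ρ` does not charge the origin, integrates
`1 ∧ ‖x‖²`, and the characteristic function of `μ` has the Lévy–Khintchine form with some drift
`b`, some Gaussian covariance operator `S` and the measure `ρ`. -/
def IsLevyMeasure {E : Type*} [NormedAddCommGroup E] [InnerProductSpace ℝ E]
    [FiniteDimensional ℝ E] [MeasurableSpace E] [BorelSpace E] (μ ρ : Measure E) : Prop :=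
  ρ {0} = 0 ∧
  ∫⁻ x, ENNReal.ofReal (min 1 (‖x‖ ^ 2)) ∂ρ < ∞ ∧
  ∃ (b : E) (S : E →L[ℝ] E), S.IsPositive ∧ ∀ u : E,
    charFun μ u = Complex.exp
      ((inner ℝ b u : ℝ) * Complex.I - ((inner ℝ (S u) u : ℝ) : ℂ) / 2
        + ∫ x, (Complex.exp ((inner ℝ x u : ℝ) * Complex.I) - 1
            - if ‖x‖ ≤ 1 then (inner ℝ x u : ℝ) * Complex.I else 0) ∂ρ)

/-- `IsProcessLevyMeasure P ξ ν`: the measure `ν` on the path space `T → ℝ`, with its cylindrical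
σ-algebra, is the Lévy measure of the (infinitely divisible) process `ξ`: its finite-dimensional
projections are, off the origin, the Lévy measures of the finite-dimensional marginals of `ξ`, and
`ν A` is the inner `ν`-measure of `A \ {0}` for every measurable `A`. -/
def IsProcessLevyMeasure {Ω T : Type*} [MeasurableSpace Ω] (P : Measure Ω)
    (ξ : T → Ω → ℝ) (ν : Measure (T → ℝ)) : Prop :=
  (∀ I : Finset T,
    IsLevyMeasure (P.map fun ω ↦ (WithLp.toLp 2 fun i : I ↦ ξ i ω : EuclideanSpace ℝ I))
      ((ν.map fun f ↦ (WithLp.toLp 2 fun i : I ↦ f i : EuclideanSpace ℝ I)).restrict {0}ᶜ)) ∧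
  ∀ A : Set (T → ℝ), MeasurableSet A →
    ν A = ⨆ (B : Set (T → ℝ)) (_ : MeasurableSet B) (_ : B ⊆ A \ {0}), ν B

/-- A double-sided real Lévy process. -/
structure IsTwoSidedLevyProcess {Ω : Type*} [MeasurableSpace Ω] (P : Measure Ω)
    (Y : ℝ → Ω → ℝ) : Prop where
  measurable : ∀ s, Measurable (Y s)
  zero : ∀ᵐ ω ∂P, Y 0 ω = 0
  indep : HasIndepIncrements Y P
  stationary : ∀ r s h : ℝ, IdentDistrib (fun ω ↦ Y (s + h) ω - Y (r + h) ω)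
    (fun ω ↦ Y s ω - Y r ω) P P
  cadlag : ∀ᵐ ω ∂P, ∀ s : ℝ, ContinuousWithinAt (fun r ↦ Y r ω) (Set.Ici s) s ∧
    ∃ l : ℝ, Tendsto (fun r ↦ Y r ω) (𝓝[<] s) (𝓝 l)

/-- The pathwise integral `∫_{(a,b]} g(s) dy(s)` of a smooth function `g` against a càdlàg path
`y`, evaluated by parts. -/
def pathIntegral (g y : ℝ → ℝ) (a b : ℝ) : ℝ :=
  g b * y b - g a * y a - ∫ s in a..b, y s * deriv g s

/-- The process `X_t = ∫_{ln (t^{-H})}^∞ e^{-s} dY_s`, `t ≥ 0`, as an improper pathwise integral.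
For `t = 0` the lower limit is `+∞` and the integral is `0`. -/
def satoProcess {Ω : Type*} (Y : ℝ → Ω → ℝ) (H : ℝ) (t : ℝ≥0) (ω : Ω) : ℝ :=
  if t = 0 then 0
  else limUnder atTop fun b : ℝ ↦
    pathIntegral (fun s ↦ Real.exp (-s)) (fun s ↦ Y s ω) (Real.log ((t : ℝ) ^ (-H))) b

/-- The deterministic path `t ↦ x e^{-s} 1_{[e^{-s/H}, ∞)}(t)`, `t ≥ 0`. -/
def jumpPath (H s x : ℝ) (t : ℝ≥0) : ℝ :=
  x * Real.exp (-s) * (Set.Ici (Real.exp (-s / H))).indicator 1 (t : ℝ)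

end

/-! Uniqueness and existence are independent of each other. A Lévy–Khintchine exponent is determined
by the law, because its value at the origin fixes the branch of the logarithm. Its second
differences are, up to sign, characteristic functions of finite measures from which the jump measure
can be read off (`IsLevyMeasure.unique`). Hence two Lévy measures of one process agree on each set
`{f | ε < |f t|}`, where they are finite and determined by their projections. A measurable set that
misses the zero path depends on countably many coordinates, so countably many such sets cover it,
and condition (ii) reduces every other set to this case (`IsProcessLevyMeasure.unique`).

For existence, let `ψ` be the exponent of `Y 1`. Riemann sums of independent increments give the
characteristic function `exp (∫ ψ (h s) ds)` for the integral of a combination `h` of the functions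
`e^{-s} 1_{[a, b)}` (`charFun_sum_pathIntegral`). The logarithmic moment bounds the paths by `C
e^{s/2}`, through Ottaviani's inequality and Borel–Cantelli (`ae_exists_abs_le_exp_half`), so the
integrals converge as `b → ∞`. Passing to the limit in the exponent requires `1 ∧ (x e^{-s})²` to be
integrable for `ds ⊗ ρ` on half-lines. This follows from the convergence itself: the limit has a
characteristic function close to `1` near the origin, which bounds the jump parts of the exponents
uniformly in `b` (`lintegral_min_one_sq_lt_top`). Fubini then gives a Lévy–Khintchine exponent whose
jump measure is the image of `ds ⊗ ρ`; the change of truncation goes into the drift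
(`exists_integral_levyExponent_inner`). Condition (ii) holds because `ρ {0} = 0` and a path with `x
≠ 0` is nonzero at some integer time. -/

noncomputable section

/-! ### Lévy–Khintchine exponents: bounds, continuity, second differences. -/

section LevyKhintchine

variable {E : Type*} [NormedAddCommGroup E]

section

variable [MeasurableSpace E] [BorelSpace E]

lemma integrable_min_one_sq {ρ : Measure E}
    (h : ∫⁻ x, ENNReal.ofReal (min 1 (‖x‖ ^ 2)) ∂ρ < ∞) :
    Integrable (fun x ↦ min 1 (‖x‖ ^ 2)) ρ := by
  refine ⟨(by fun_prop : Measurable fun x : E ↦ min 1 (‖x‖ ^ 2)).aestronglyMeasurable, ?_⟩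
  rw [hasFiniteIntegral_iff_ofReal (Eventually.of_forall fun x ↦ by positivity)]
  exact h

/-- The weight `1 ∧ ‖x‖²` is positive off the origin and has finite integral, so `ρ` is a finite
measure divided by a positive density. Fubini for `ds ⊗ ρ` rests on this. -/
lemma sigmaFinite_of_lintegral_min_lt_top {ρ : Measure E} (h0 : ρ {0} = 0)
    (h : ∫⁻ x, ENNReal.ofReal (min 1 (‖x‖ ^ 2)) ∂ρ < ∞) : SigmaFinite ρ := by
  have hm : Measurable fun x : E ↦ ENNReal.ofReal (min 1 (‖x‖ ^ 2)) := by fun_prop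
  have : IsFiniteMeasure (ρ.withDensity fun x : E ↦ ENNReal.ofReal (min 1 (‖x‖ ^ 2))) :=
    isFiniteMeasure_withDensity h.ne
  have hpos : ∀ᵐ x ∂ρ, ENNReal.ofReal (min 1 (‖x‖ ^ 2)) ≠ 0 := by
    have : ∀ᵐ x ∂ρ, x ≠ 0 := by simpa [ae_iff] using h0
    filter_upwards [this] with x hx
    simp [hx]
  rw [← withDensity_inv_same hm hpos (Eventually.of_forall fun x ↦ ENNReal.ofReal_ne_top)]
  refine SigmaFinite.withDensity_of_ne_top ?_
  rw [ae_withDensity_iff hm]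
  exact Eventually.of_forall fun x hx ↦ by simpa using hx

end

variable [InnerProductSpace ℝ E]

/-- The compensated exponential in the Lévy–Khintchine formula. -/
def levyKernel (x u : E) : ℂ :=
  Complex.exp ((inner ℝ x u : ℝ) * Complex.I) - 1
    - if ‖x‖ ≤ 1 then (inner ℝ x u : ℝ) * Complex.I else 0

lemma norm_exp_mul_I_sub_one_le_two (y : ℝ) : ‖Complex.exp (y * Complex.I) - 1‖ ≤ 2 := by
  refine (norm_sub_le _ _).trans ?_
  rw [Complex.norm_exp_ofReal_mul_I]
  norm_num

lemma norm_exp_mul_I_sub_one_sub_le (y : ℝ) :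
    ‖Complex.exp (y * Complex.I) - 1 - y * Complex.I‖ ≤ 3 * y ^ 2 := by
  have hn : ‖(y : ℂ) * Complex.I‖ = |y| := by simp
  rcases le_or_gt |y| 1 with h | h
  · have := Complex.norm_exp_sub_one_sub_id_le (x := y * Complex.I) (by rwa [hn])
    rw [hn, sq_abs] at this
    nlinarith [sq_nonneg y]
  · refine (norm_sub_le _ _).trans ?_
    have := norm_exp_mul_I_sub_one_le_two y
    rw [hn]
    nlinarith [sq_abs y]

/-- Small jumps are compensated and contribute the quadratic term; large jumps contribute at most
`2`. -/
lemma norm_levyKernel_le (x u : E) :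
    ‖levyKernel x u‖ ≤ (2 + 3 * ‖u‖ ^ 2) * min 1 (‖x‖ ^ 2) := by
  unfold levyKernel
  split_ifs with h
  · have h2 : min 1 (‖x‖ ^ 2) = ‖x‖ ^ 2 := min_eq_right (by nlinarith [norm_nonneg x])
    rw [h2]
    refine (norm_exp_mul_I_sub_one_sub_le _).trans ?_
    have h3 : (inner ℝ x u) ^ 2 ≤ (‖x‖ * ‖u‖) ^ 2 := by
      rw [← sq_abs]
      exact pow_le_pow_left₀ (abs_nonneg _) (abs_real_inner_le_norm x u) 2
    nlinarith [sq_nonneg ‖x‖]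
  · push Not at h
    have h2 : min 1 (‖x‖ ^ 2) = 1 := min_eq_left (by nlinarith [norm_nonneg x])
    rw [h2, sub_zero]
    refine (norm_exp_mul_I_sub_one_le_two _).trans ?_
    nlinarith [sq_nonneg ‖u‖]

lemma continuous_levyKernel_right (x : E) : Continuous (levyKernel x) := by
  unfold levyKernel
  split_ifs <;> fun_prop

@[simp] lemma levyKernel_zero_right (x : E) : levyKernel x 0 = 0 := by
  simp [levyKernel]

/-- The compensator is linear in `u`, so it has no second difference, whatever the truncation. What
remains is a nonnegative weight times a character, that is, the integrand of a characteristic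
function. -/
lemma levyKernel_second_difference (x u w : E) :
    levyKernel x (u + w) + levyKernel x (u - w) - 2 * levyKernel x u
      = -(((2 - 2 * Real.cos (inner ℝ x w) : ℝ) : ℂ) *
        Complex.exp ((inner ℝ x u : ℝ) * Complex.I)) := by
  have h : levyKernel x (u + w) + levyKernel x (u - w) - 2 * levyKernel x u
      = Complex.exp ((inner ℝ x u : ℝ) * Complex.I + (inner ℝ x w : ℝ) * Complex.I)
        + Complex.exp ((inner ℝ x u : ℝ) * Complex.I + -((inner ℝ x w : ℝ) * Complex.I))
        - 2 * Complex.exp ((inner ℝ x u : ℝ) * Complex.I) := by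
    unfold levyKernel
    rw [inner_add_right, inner_sub_right]
    split_ifs <;> push_cast <;> simp only [sub_eq_add_neg, add_mul, neg_mul] <;> ring
  rw [h, Complex.exp_add, Complex.exp_add]
  push_cast
  rw [Complex.cos, ← neg_mul]
  ring

variable [MeasurableSpace E]

/-- The exponent in the Lévy–Khintchine formula with drift `b`, covariance `S`, Lévy measure `ρ`. -/
def levyExponent (b : E) (S : E →L[ℝ] E) (ρ : Measure E) (u : E) : ℂ :=
  (inner ℝ b u : ℝ) * Complex.I - ((inner ℝ (S u) u : ℝ) : ℂ) / 2 + ∫ x, levyKernel x u ∂ρ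

@[simp] lemma levyExponent_zero (b : E) (S : E →L[ℝ] E) (ρ : Measure E) :
    levyExponent b S ρ 0 = 0 := by
  simp [levyExponent]

variable [BorelSpace E]

@[fun_prop]
lemma measurable_levyKernel [SecondCountableTopology E] {α : Type*} [MeasurableSpace α]
    {f g : α → E} (hf : Measurable f) (hg : Measurable g) :
    Measurable fun a ↦ levyKernel (f a) (g a) := by
  unfold levyKernel
  refine Measurable.sub (by fun_prop) (Measurable.ite ?_ (by fun_prop) measurable_const)
  exact measurableSet_le (by fun_prop) measurable_const

lemma integrable_levyKernel [SecondCountableTopology E] {ρ : Measure E}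
    (h : ∫⁻ x, ENNReal.ofReal (min 1 (‖x‖ ^ 2)) ∂ρ < ∞) (u : E) :
    Integrable (fun x ↦ levyKernel x u) ρ :=
  ((integrable_min_one_sq h).const_mul _).mono'
    (by fun_prop : Measurable fun x : E ↦ levyKernel x u).aestronglyMeasurable
    (Eventually.of_forall fun x ↦ norm_levyKernel_le x u)

lemma continuous_levyExponent [SecondCountableTopology E] {ρ : Measure E}
    (h : ∫⁻ x, ENNReal.ofReal (min 1 (‖x‖ ^ 2)) ∂ρ < ∞) (b : E) (S : E →L[ℝ] E) :
    Continuous (levyExponent b S ρ) := by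
  unfold levyExponent
  refine Continuous.add (by fun_prop) ?_
  rw [continuous_iff_continuousAt]
  intro u₀
  refine continuousAt_of_dominated
    (bound := fun x ↦ (2 + 3 * (‖u₀‖ + 1) ^ 2) * min 1 (‖x‖ ^ 2)) ?_ ?_ ?_ ?_
  · exact Eventually.of_forall fun u ↦
      (by fun_prop : Measurable fun x : E ↦ levyKernel x u).aestronglyMeasurable
  · filter_upwards [Metric.ball_mem_nhds u₀ one_pos] with u hu
    refine Eventually.of_forall fun x ↦ (norm_levyKernel_le x u).trans ?_
    have : ‖u‖ ≤ ‖u₀‖ + 1 := by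
      have h1 := norm_le_norm_add_norm_sub' u u₀
      rw [mem_ball_iff_norm] at hu
      linarith
    gcongr
  · exact (integrable_min_one_sq h).const_mul _
  · exact Eventually.of_forall fun x ↦ (continuous_levyKernel_right x).continuousAt

end LevyKhintchine

/-- The difference takes values in the discrete set `2πiℤ`, so the set where the functions agree is
clopen. -/
lemma eq_of_exp_comp_eq {X : Type*} [TopologicalSpace X] [PreconnectedSpace X] {f g : X → ℂ}
    (hf : Continuous f) (hg : Continuous g) (h : ∀ x, Complex.exp (f x) = Complex.exp (g x))
    {x₀ : X} (h₀ : f x₀ = g x₀) : f = g := by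
  have hcl : IsClosed {x | f x = g x} := isClosed_eq hf hg
  have hop : {x | f x = g x} = {x | ‖f x - g x‖ < 1} := by
    ext x
    refine ⟨fun hx ↦ by simp [show f x = g x from hx], fun hx ↦ ?_⟩
    obtain ⟨n, hn⟩ := Complex.exp_eq_exp_iff_exists_int.1 (h x)
    have h1 : f x - g x = n * (2 * Real.pi * Complex.I) := by rw [hn]; ring
    have h2 : ‖f x - g x‖ = |(n : ℝ)| * (2 * Real.pi) := by
      rw [h1]
      simp [abs_of_pos Real.pi_pos]
    have hx' : |(n : ℝ)| * (2 * Real.pi) < 1 := h2 ▸ hx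
    have hn0 : n = 0 := by
      by_contra hne
      have : (1 : ℝ) ≤ |(n : ℝ)| := by exact_mod_cast Int.one_le_abs hne
      nlinarith [Real.pi_gt_three]
    simpa [hn0, sub_eq_zero] using h1
  have hclopen : IsClopen {x | f x = g x} :=
    ⟨hcl, by rw [hop]; exact isOpen_lt (by fun_prop) continuous_const⟩
  have := hclopen.eq_univ ⟨x₀, h₀⟩
  ext1 x
  exact (this ▸ Set.mem_univ x : x ∈ {x | f x = g x})

/-! ### Uniqueness of the Lévy measure of a law on a Euclidean space. -/

section Uniqueness

variable {E : Type*} [NormedAddCommGroup E] [InnerProductSpace ℝ E] [FiniteDimensional ℝ E]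
  [MeasurableSpace E] [BorelSpace E]

lemma IsLevyMeasure.exists_levyExponent {μ ρ : Measure E} (h : IsLevyMeasure μ ρ) :
    ∃ (b : E) (S : E →L[ℝ] E), S.IsPositive ∧
      ∀ u, charFun μ u = Complex.exp (levyExponent b S ρ u) := h.2.2

lemma two_sub_two_mul_cos_nonneg (y : ℝ) : 0 ≤ 2 - 2 * Real.cos y := by
  linarith [Real.cos_le_one y]

lemma integrable_two_sub_two_mul_cos {ρ : Measure E}
    (h : ∫⁻ x, ENNReal.ofReal (min 1 (‖x‖ ^ 2)) ∂ρ < ∞) (w : E) :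
    Integrable (fun x ↦ 2 - 2 * Real.cos (inner ℝ x w)) ρ := by
  have h1 := ((integrable_levyKernel h (0 + w)).add (integrable_levyKernel h (0 - w))).sub
    ((integrable_levyKernel h (0 : E)).const_mul 2)
  have h2 := h1.neg.re
  refine h2.congr (Eventually.of_forall fun x ↦ ?_)
  have h3 := levyKernel_second_difference x 0 w
  simp only [Pi.neg_apply, Pi.sub_apply, Pi.add_apply] at *
  rw [h3, neg_neg, inner_zero_right, Complex.ofReal_zero, zero_mul, Complex.exp_zero, mul_one]
  exact Complex.ofReal_re _

/-- The drift cancels and the Gaussian part leaves a constant in `u`, which will be an atom at the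
origin. -/
lemma levyExponent_second_difference {ρ : Measure E}
    (h : ∫⁻ x, ENNReal.ofReal (min 1 (‖x‖ ^ 2)) ∂ρ < ∞) (b : E) {S : E →L[ℝ] E}
    (u w : E) :
    levyExponent b S ρ (u + w) + levyExponent b S ρ (u - w) - 2 * levyExponent b S ρ u
      = -(∫ x, ((2 - 2 * Real.cos (inner ℝ x w) : ℝ) : ℂ) *
        Complex.exp ((inner ℝ x u : ℝ) * Complex.I) ∂ρ + (inner ℝ (S w) w : ℝ)) := by
  have h1 : ∫ x, levyKernel x (u + w) ∂ρ + ∫ x, levyKernel x (u - w) ∂ρ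
      - 2 * ∫ x, levyKernel x u ∂ρ
      = -∫ x, ((2 - 2 * Real.cos (inner ℝ x w) : ℝ) : ℂ) *
        Complex.exp ((inner ℝ x u : ℝ) * Complex.I) ∂ρ := by
    rw [← integral_add (integrable_levyKernel h _) (integrable_levyKernel h _),
      ← integral_const_mul, ← integral_sub (by
        exact (integrable_levyKernel h _).add (integrable_levyKernel h _))
        ((integrable_levyKernel h _).const_mul 2), ← integral_neg]
    exact integral_congr_ae (Eventually.of_forall fun x ↦ levyKernel_second_difference x u w)
  unfold levyExponent
  rw [neg_add, ← h1]
  simp only [map_add, map_sub, inner_add_left, inner_add_right, inner_sub_left, inner_sub_right]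
  push_cast
  ring

/-- The finite measure whose characteristic function is minus the second difference of the
Lévy–Khintchine exponent in the direction `w`. -/
def secondDifferenceMeasure (S : E →L[ℝ] E) (ρ : Measure E) (w : E) : Measure E :=
  ρ.withDensity (fun x ↦ ENNReal.ofReal (2 - 2 * Real.cos (inner ℝ x w)))
    + ENNReal.ofReal (inner ℝ (S w) w) • Measure.dirac 0

lemma isFiniteMeasure_secondDifferenceMeasure {ρ : Measure E}
    (h : ∫⁻ x, ENNReal.ofReal (min 1 (‖x‖ ^ 2)) ∂ρ < ∞) (S : E →L[ℝ] E) (w : E) :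
    IsFiniteMeasure (secondDifferenceMeasure S ρ w) := by
  have h1 := (integrable_two_sub_two_mul_cos h w).2
  rw [hasFiniteIntegral_iff_ofReal
    (Eventually.of_forall fun x ↦ two_sub_two_mul_cos_nonneg _)] at h1
  have := isFiniteMeasure_withDensity h1.ne
  have : IsFiniteMeasure (ENNReal.ofReal (inner ℝ (S w) w) • Measure.dirac (0 : E)) :=
    Measure.smul_finite _ ENNReal.ofReal_ne_top
  unfold secondDifferenceMeasure
  infer_instance

lemma charFun_secondDifferenceMeasure {ρ : Measure E}
    (h : ∫⁻ x, ENNReal.ofReal (min 1 (‖x‖ ^ 2)) ∂ρ < ∞) (b : E) {S : E →L[ℝ] E}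
    (hS : S.IsPositive) (u w : E) :
    charFun (secondDifferenceMeasure S ρ w) u
      = -(levyExponent b S ρ (u + w) + levyExponent b S ρ (u - w) - 2 * levyExponent b S ρ u) := by
  have hfin := isFiniteMeasure_secondDifferenceMeasure h S w
  rw [levyExponent_second_difference h, neg_neg, charFun_apply, secondDifferenceMeasure]
  have hint : Integrable (fun x : E ↦ Complex.exp ((inner ℝ x u : ℝ) * Complex.I))
      (secondDifferenceMeasure S ρ w) := by
    refine Integrable.of_bound (Measurable.aestronglyMeasurable (by fun_prop)) 1
      (Eventually.of_forall fun x ↦ ?_)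
    rw [Complex.norm_exp_ofReal_mul_I]
  rw [integral_add_measure (hint.mono_measure (Measure.le_add_right le_rfl))
    (hint.mono_measure (Measure.le_add_left le_rfl)), integral_smul_measure, integral_dirac,
    integral_withDensity_eq_integral_toReal_smul (by fun_prop)
      (Eventually.of_forall fun x ↦ ENNReal.ofReal_lt_top)]
  congr 1
  · refine integral_congr_ae (Eventually.of_forall fun x ↦ ?_)
    simp only
    rw [ENNReal.toReal_ofReal (two_sub_two_mul_cos_nonneg _), Complex.real_smul]
  · rw [ENNReal.toReal_ofReal (hS.inner_nonneg_left w)]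
    simp

/-- The Lévy measure of an infinitely divisible law on a Euclidean space is unique. -/
theorem IsLevyMeasure.unique {μ ρ₁ ρ₂ : Measure E} (h₁ : IsLevyMeasure μ ρ₁)
    (h₂ : IsLevyMeasure μ ρ₂) : ρ₁ = ρ₂ := by
  obtain ⟨b₁, S₁, hS₁, hb₁⟩ := h₁.exists_levyExponent
  obtain ⟨b₂, S₂, hS₂, hb₂⟩ := h₂.exists_levyExponent
  have hexp : levyExponent b₁ S₁ ρ₁ = levyExponent b₂ S₂ ρ₂ :=
    eq_of_exp_comp_eq (continuous_levyExponent h₁.2.1 _ _) (continuous_levyExponent h₂.2.1 _ _)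
      (fun u ↦ by rw [← hb₁, hb₂]) (x₀ := 0) (by simp)
  have hsd (w : E) : secondDifferenceMeasure S₁ ρ₁ w = secondDifferenceMeasure S₂ ρ₂ w := by
    have := isFiniteMeasure_secondDifferenceMeasure h₁.2.1 S₁ w
    have := isFiniteMeasure_secondDifferenceMeasure h₂.2.1 S₂ w
    refine Measure.ext_of_charFun (funext fun u ↦ ?_)
    rw [charFun_secondDifferenceMeasure h₁.2.1 b₁ hS₁, charFun_secondDifferenceMeasure h₂.2.1 b₂ hS₂,
      hexp]
  -- `A w` is where the weight `2 - 2 cos ⟨x, w⟩` is positive. It omits the origin, so the Gaussian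
  -- atom drops out and dividing by the weight recovers `ρ` there.
  let A (w : E) : Set E := {x | Real.cos (inner ℝ x w) ≠ 1}
  have hA (w : E) : MeasurableSet (A w) :=
    (measurableSet_eq_fun (by fun_prop) measurable_const).compl
  have hrec (ρ : Measure E) (S : E →L[ℝ] E) (w : E) :
      ρ.restrict (A w) = ((secondDifferenceMeasure S ρ w).restrict (A w)).withDensity
        (fun x ↦ (ENNReal.ofReal (2 - 2 * Real.cos (inner ℝ x w)))⁻¹) := by
    have h0 : (Measure.dirac (0 : E)).restrict (A w) = 0 := by
      rw [Measure.restrict_eq_zero, Measure.dirac_apply' _ (hA w)]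
      simp [A]
    rw [secondDifferenceMeasure, Measure.restrict_add, Measure.restrict_smul, h0, smul_zero,
      add_zero, restrict_withDensity (hA w), withDensity_inv_same (by fun_prop) ?_
        (Eventually.of_forall fun x ↦ ENNReal.ofReal_ne_top)]
    refine ae_restrict_of_forall_mem (hA w) fun x hx ↦ ?_
    have : Real.cos (inner ℝ x w) < 1 := lt_of_le_of_ne (Real.cos_le_one _) hx
    simp only [ne_eq, ENNReal.ofReal_eq_zero, not_le]
    linarith
  -- For fixed `x ≠ 0` the good directions form an open set, nonempty because `w = x / ‖x‖²` gives
  -- `cos 1 < 1`; hence a dense sequence of directions meets it.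
  have hcover : ⋃ n, A (TopologicalSpace.denseSeq E n) = {0}ᶜ := by
    ext x
    simp only [Set.mem_iUnion, Set.mem_compl_iff, Set.mem_singleton_iff]
    constructor
    · rintro ⟨n, hn⟩ rfl
      simp [A] at hn
    · intro hx
      have hop : IsOpen {w : E | Real.cos (inner ℝ x w) ≠ 1} :=
        isOpen_ne_fun (by fun_prop) continuous_const
      exact (TopologicalSpace.denseRange_denseSeq E).exists_mem_open hop
        ⟨(‖x‖ ^ 2)⁻¹ • x, by
          have : ‖x‖ ≠ 0 := norm_ne_zero_iff.2 hx
          rw [Set.mem_ofPred_eq, inner_smul_right, real_inner_self_eq_norm_sq,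
            inv_mul_cancel₀ (by positivity)]
          exact (Real.cos_one_le.trans_lt (by norm_num)).ne⟩
  have hres : ρ₁.restrict {0}ᶜ = ρ₂.restrict {0}ᶜ := by
    rw [← hcover, Measure.restrict_iUnion_congr]
    intro n
    rw [hrec ρ₁ S₁, hrec ρ₂ S₂, hsd]
  rwa [Measure.restrict_eq_self_of_ae_mem, Measure.restrict_eq_self_of_ae_mem] at hres
  · simpa [ae_iff] using h₂.1
  · simpa [ae_iff] using h₁.1

end Uniqueness

/-! ### Uniqueness of the Lévy measure of a process. -/

section ProcessLevyMeasure

variable {T : Type*}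

/-- A measurable subset of a product space is determined by countably many coordinates. -/
lemma MeasurableSet.exists_countable_coordinates {A : Set (T → ℝ)} (hA : MeasurableSet A) :
    ∃ J : Set T, J.Countable ∧ ∀ f g : T → ℝ, (∀ t ∈ J, f t = g t) → (f ∈ A ↔ g ∈ A) := by
  rw [← generateFrom_measurableCylinders] at hA
  induction A, hA using MeasurableSpace.generateFrom_induction with
  | hC s hs _ =>
    obtain ⟨I, S, -, rfl⟩ := (mem_measurableCylinders _).1 hs
    refine ⟨I, I.countable_toSet, fun f g hfg ↦ ?_⟩
    have : I.restrict f = I.restrict g := funext fun i ↦ hfg i i.2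
    simp [this]
  | empty => exact ⟨∅, Set.countable_empty, by simp⟩
  | compl s _ ih =>
    obtain ⟨J, hJ, h⟩ := ih
    exact ⟨J, hJ, fun f g hfg ↦ not_congr (h f g hfg)⟩
  | iUnion s _ ih =>
    choose J hJ h using ih
    refine ⟨⋃ n, J n, Set.countable_iUnion hJ, fun f g hfg ↦ ?_⟩
    simp only [Set.mem_iUnion]
    exact exists_congr fun n ↦ h n f g fun t ht ↦ hfg t (Set.mem_iUnion.2 ⟨n, ht⟩)

lemma measurable_toLp_restrict (I : Finset T) :
    Measurable fun f : T → ℝ ↦ (WithLp.toLp 2 fun i : I ↦ f i : EuclideanSpace ℝ I) := by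
  fun_prop

variable {Ω : Type*} [MeasurableSpace Ω] {P : Measure Ω} {ξ : T → Ω → ℝ} {ν ν₁ ν₂ : Measure (T → ℝ)}

/-- Markov's inequality for `1 ∧ ‖x‖²` under the projection to the single time `t`. Finiteness is
what makes uniqueness of projective limits applicable. -/
lemma IsProcessLevyMeasure.measure_lt_abs_lt_top (h : IsProcessLevyMeasure P ξ ν) (t : T)
    {ε : ℝ} (hε : 0 < ε) : ν {f | ε < |f t|} < ∞ := by
  have h1 := integrable_min_one_sq (h.1 {t}).2.1
  have hδ : 0 < min 1 (ε ^ 2) := by positivity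
  have h2 := h1.measure_norm_ge_lt_top hδ
  refine lt_of_le_of_lt ?_ h2
  have hms : MeasurableSet {x : EuclideanSpace ℝ ({t} : Finset T) |
      min 1 (ε ^ 2) ≤ ‖min 1 (‖x‖ ^ 2)‖} := measurableSet_le (by fun_prop) (by fun_prop)
  rw [Measure.restrict_apply hms, Measure.map_apply (measurable_toLp_restrict _)
    (hms.inter (measurableSet_singleton 0).compl)]
  refine measure_mono fun f hf ↦ ?_
  have hf' : ε < |f t| := hf
  have ht : t ∈ ({t} : Finset T) := Finset.mem_singleton_self t
  have hle : |f t| ≤ ‖(WithLp.toLp 2 fun i : ({t} : Finset T) ↦ f i :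
      EuclideanSpace ℝ ({t} : Finset T))‖ := by
    simpa using PiLp.norm_apply_le (WithLp.toLp 2 fun i : ({t} : Finset T) ↦ f i :
      EuclideanSpace ℝ ({t} : Finset T)) ⟨t, ht⟩
  refine ⟨?_, ?_⟩
  · change min 1 (ε ^ 2) ≤ ‖min 1 (_ ^ 2)‖
    rw [Real.norm_of_nonneg (by positivity)]
    gcongr
    exact hf'.le.trans hle
  · intro h0
    simp only [Set.mem_singleton_iff] at h0
    rw [h0, norm_zero] at hle
    linarith

lemma IsProcessLevyMeasure.restrict_lt_abs_eq (h₁ : IsProcessLevyMeasure P ξ ν₁)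
    (h₂ : IsProcessLevyMeasure P ξ ν₂) (t : T) {ε : ℝ} (hε : 0 < ε) :
    ν₁.restrict {f | ε < |f t|} = ν₂.restrict {f | ε < |f t|} := by
  classical
  have hC : MeasurableSet {f : T → ℝ | ε < |f t|} := measurableSet_lt (by fun_prop) (by fun_prop)
  have : IsFiniteMeasure (ν₁.restrict {f | ε < |f t|}) :=
    ⟨by simpa using h₁.measure_lt_abs_lt_top t hε⟩
  refine IsProjectiveLimit.unique (P := fun I : Finset T ↦
    (ν₁.restrict {f | ε < |f t|}).map I.restrict) (fun I ↦ rfl) (fun I ↦ ?_)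
  refine Measure.ext fun S hS ↦ ?_
  have hrm : Measurable (I.restrict : (T → ℝ) → (I → ℝ)) := Finset.measurable_restrict I
  rw [Measure.map_apply hrm hS, Measure.map_apply hrm hS, Measure.restrict_apply (hrm hS),
    Measure.restrict_apply (hrm hS)]
  -- Adding `t` to the times turns the restriction into a condition on the projection, and one that
  -- excludes the origin, where the projections are not controlled.
  set K : Finset T := insert t I
  have hI : ∀ i : I, (i : T) ∈ K := fun i ↦ Finset.mem_insert_of_mem i.2
  let D : Set (EuclideanSpace ℝ K) :=
    {x | ε < |x ⟨t, Finset.mem_insert_self t I⟩|} ∩ (fun x (i : I) ↦ x ⟨i, hI i⟩) ⁻¹' S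
  have hD : MeasurableSet D :=
    (measurableSet_lt (by fun_prop) (by fun_prop)).inter
      ((by fun_prop : Measurable fun (x : EuclideanSpace ℝ K) (i : I) ↦ x ⟨i, hI i⟩) hS)
  have hD0 : D ∩ {0}ᶜ = D := by
    rw [Set.inter_eq_left]
    rintro x ⟨hx, -⟩ rfl
    simp only [Set.mem_ofPred_eq, PiLp.zero_apply, abs_zero] at hx
    linarith
  have key (ν : Measure (T → ℝ)) : ν (I.restrict ⁻¹' S ∩ {f | ε < |f t|})
      = ((ν.map fun f ↦ (WithLp.toLp 2 fun i : K ↦ f i : EuclideanSpace ℝ K)).restrict {0}ᶜ) D := by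
    rw [Measure.restrict_apply hD, hD0, Measure.map_apply (measurable_toLp_restrict _) hD]
    congr 1
    ext f
    exact and_comm
  rw [key, key, (h₁.1 K).unique (h₂.1 K)]

/-- A process has at most one Lévy measure. -/
theorem IsProcessLevyMeasure.unique (h₁ : IsProcessLevyMeasure P ξ ν₁)
    (h₂ : IsProcessLevyMeasure P ξ ν₂) : ν₁ = ν₂ := by
  have hne (t : T) : ν₁.restrict {f | f t ≠ 0} = ν₂.restrict {f | f t ≠ 0} := by
    have : {f : T → ℝ | f t ≠ 0} = ⋃ n : ℕ, {f | 1 / ((n : ℝ) + 1) < |f t|} := by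
      ext f
      simp only [Set.mem_ofPred_eq, Set.mem_iUnion]
      refine ⟨fun hf ↦ exists_nat_one_div_lt (abs_pos.2 hf), ?_⟩
      rintro ⟨n, hn⟩ h0
      rw [h0, abs_zero] at hn
      exact absurd hn (not_lt.2 (by positivity))
    rw [this, Measure.restrict_iUnion_congr]
    exact fun n ↦ h₁.restrict_lt_abs_eq h₂ t (by positivity)
  -- If all coordinates in `J` of a path in `B` vanished, the zero path would lie in `B` too.
  have hB (B : Set (T → ℝ)) (hB : MeasurableSet B) (h0 : 0 ∉ B) : ν₁ B = ν₂ B := by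
    obtain ⟨J, hJ, hdep⟩ := hB.exists_countable_coordinates
    have hsub : B ⊆ ⋃ t ∈ J, {f | f t ≠ 0} := by
      intro f hf
      by_contra hcon
      simp only [Set.mem_iUnion, not_exists, Set.mem_ofPred_eq, not_not] at hcon
      exact h0 ((hdep f 0 fun t ht ↦ hcon t ht).1 hf)
    have hU : ν₁.restrict (⋃ t ∈ J, {f | f t ≠ 0}) = ν₂.restrict (⋃ t ∈ J, {f | f t ≠ 0}) :=
      (Measure.restrict_biUnion_congr hJ).2 fun t _ ↦ hne t
    have := congrArg (fun m ↦ m B) hU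
    simpa only [Measure.restrict_apply hB, Set.inter_eq_left.2 hsub] using this
  refine Measure.ext fun A hA ↦ ?_
  rw [h₁.2 A hA, h₂.2 A hA]
  refine iSup_congr fun B ↦ iSup_congr fun hBm ↦ iSup_congr fun hBs ↦ hB B hBm fun h0 ↦ ?_
  exact (hBs h0).2 rfl

end ProcessLevyMeasure

/-! ### Rounding up to a grid, for right-continuous functions. -/

section CeilGrid

/-- The least multiple of `1 / (n + 1)` that is not smaller than `s`. -/
def ceilGrid (n : ℕ) (s : ℝ) : ℝ := ⌈s * (n + 1)⌉ / ((n : ℝ) + 1)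

lemma le_ceilGrid (n : ℕ) (s : ℝ) : s ≤ ceilGrid n s := by
  rw [ceilGrid, le_div_iff₀ (by positivity)]
  exact Int.le_ceil _

lemma ceilGrid_lt (n : ℕ) (s : ℝ) : ceilGrid n s < s + 1 / ((n : ℝ) + 1) := by
  have : (0 : ℝ) < n + 1 := by positivity
  rw [ceilGrid, div_lt_iff₀ this, add_mul, one_div, inv_mul_cancel₀ this.ne']
  exact Int.ceil_lt_add_one _

lemma ceilGrid_le_add_one (n : ℕ) (s : ℝ) : ceilGrid n s ≤ s + 1 := by
  refine (ceilGrid_lt n s).le.trans ?_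
  gcongr
  rw [div_le_one (by positivity)]
  linarith [n.cast_nonneg (α := ℝ)]

lemma tendsto_ceilGrid (s : ℝ) : Tendsto (fun n ↦ ceilGrid n s) atTop (𝓝 s) := by
  have h := (tendsto_one_div_add_atTop_nhds_zero_nat (𝕜 := ℝ)).const_add s
  rw [add_zero] at h
  exact tendsto_of_tendsto_of_tendsto_of_le_of_le tendsto_const_nhds h
    (fun n ↦ le_ceilGrid n s) (fun n ↦ (ceilGrid_lt n s).le)

lemma tendsto_comp_ceilGrid {β : Type*} [TopologicalSpace β] {y : ℝ → β} {s : ℝ}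
    (hy : ContinuousWithinAt y (Set.Ici s) s) :
    Tendsto (fun n ↦ y (ceilGrid n s)) atTop (𝓝 (y s)) :=
  hy.tendsto.comp (tendsto_nhdsWithin_iff.2
    ⟨tendsto_ceilGrid s, Eventually.of_forall fun n ↦ le_ceilGrid n s⟩)

lemma measurable_comp_ceilGrid {β : Type*} [MeasurableSpace β] (y : ℝ → β) (n : ℕ) :
    Measurable fun s ↦ y (ceilGrid n s) := by
  have h1 : Measurable fun k : ℤ ↦ y (k / ((n : ℝ) + 1)) := measurable_of_countable _
  exact h1.comp (Int.measurable_ceil.comp (by fun_prop : Measurable fun s : ℝ ↦ s * (n + 1)))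

/-- Rounding upwards approaches `s` from the right, so right continuity alone gives pointwise
convergence of step functions. -/
lemma measurable_of_rightContinuous {β : Type*} [TopologicalSpace β]
    [TopologicalSpace.PseudoMetrizableSpace β] [MeasurableSpace β] [BorelSpace β] {y : ℝ → β}
    (hy : ∀ s, ContinuousWithinAt y (Set.Ici s) s) : Measurable y :=
  measurable_of_tendsto_metrizable (fun n ↦ measurable_comp_ceilGrid y n)
    (tendsto_pi_nhds.2 fun s ↦ tendsto_comp_ceilGrid (hy s))

end CeilGrid

/-! ### Limits and roots of characteristic functions. -/

lemma tendsto_charFun_map_of_ae_tendsto {Ω E : Type*} [MeasurableSpace Ω] {P : Measure Ω}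
    [IsFiniteMeasure P] [NormedAddCommGroup E] [InnerProductSpace ℝ E] [MeasurableSpace E]
    [BorelSpace E] [SecondCountableTopology E] {V : ℕ → Ω → E} {W : Ω → E}
    (hV : ∀ n, AEMeasurable (V n) P)
    (h : ∀ᵐ ω ∂P, Tendsto (fun n ↦ V n ω) atTop (𝓝 (W ω))) (u : E) :
    Tendsto (fun n ↦ charFun (P.map (V n)) u) atTop (𝓝 (charFun (P.map W) u)) := by
  have hW : AEMeasurable W P := aemeasurable_of_tendsto_metrizable_ae atTop hV h
  have hc : Continuous fun x : E ↦ Complex.exp ((inner ℝ x u : ℝ) * Complex.I) := by fun_prop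
  have key (Z : Ω → E) (hZ : AEMeasurable Z P) : charFun (P.map Z) u
      = ∫ ω, Complex.exp ((inner ℝ (Z ω) u : ℝ) * Complex.I) ∂P := by
    rw [charFun_apply, integral_map hZ hc.aestronglyMeasurable]
  simp_rw [key W hW, fun n ↦ key (V n) (hV n)]
  refine tendsto_integral_of_dominated_convergence (fun _ ↦ 1) (fun n ↦ ?_)
    (integrable_const 1) (fun n ↦ Eventually.of_forall fun ω ↦ ?_) ?_
  · exact (hc.measurable.comp_aemeasurable (hV n)).aestronglyMeasurable
  · rw [Complex.norm_exp_ofReal_mul_I]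
  · filter_upwards [h] with ω hω
    exact (hc.tendsto _).comp hω

/-- `φ · exp (-ψ / n)` is continuous with values in the finite set of `n`-th roots of unity, hence
constant; the base point selects the root `1`. -/
lemma eq_exp_div_of_pow_eq_exp {X : Type*} [TopologicalSpace X] [PreconnectedSpace X]
    {φ ψ : X → ℂ} (hφ : Continuous φ) (hψ : Continuous ψ) {n : ℕ} (hn : n ≠ 0)
    (h : ∀ x, φ x ^ n = Complex.exp (ψ x)) {x₀ : X} (h₀ : φ x₀ = 1) (h₀' : ψ x₀ = 0) (x : X) :
    φ x = Complex.exp (ψ x / n) := by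
  have hr : ∀ x, (φ x * Complex.exp (-(ψ x / n))) ^ n = 1 := by
    intro x
    have : (n : ℂ) ≠ 0 := Nat.cast_ne_zero.2 hn
    rw [mul_pow, h, ← Complex.exp_nat_mul, ← Complex.exp_add]
    have : ψ x + n * -(ψ x / n) = 0 := by field_simp; ring
    rw [this, Complex.exp_zero]
  have hfin : Set.Finite {z : ℂ | z ^ n = 1} := by
    refine (Polynomial.nthRoots n (1 : ℂ)).toFinset.finite_toSet.subset fun z hz ↦ ?_
    simpa [Polynomial.mem_nthRoots (Nat.pos_of_ne_zero hn)] using hz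
  have hconst := isPreconnected_univ.constant_of_mapsTo hfin.isDiscrete
    (f := fun x ↦ φ x * Complex.exp (-(ψ x / n))) (Continuous.continuousOn (by fun_prop))
    (fun x _ ↦ hr x) (Set.mem_univ x) (Set.mem_univ x₀)
  simp only [h₀, h₀', zero_div, neg_zero, Complex.exp_zero, mul_one] at hconst
  rw [Complex.exp_neg] at hconst
  exact eq_of_mul_inv_eq_one hconst

/-! ### Characteristic functions of Lévy increments. -/

section Increments

variable {Ω : Type*} [MeasurableSpace Ω] {P : Measure Ω} {Y : ℝ → Ω → ℝ}

namespace IsTwoSidedLevyProcess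

lemma map_sub_eq (hY : IsTwoSidedLevyProcess P Y) (s t : ℝ) :
    P.map (fun ω ↦ Y t ω - Y s ω) = P.map (fun ω ↦ Y (t - s) ω - Y 0 ω) := by
  have := (hY.stationary 0 (t - s) s).map_eq
  simpa using this

lemma charFun_nat_mul (hY : IsTwoSidedLevyProcess P Y) {d : ℝ} (hd : 0 ≤ d) (k : ℕ) (u : ℝ) :
    charFun (P.map fun ω ↦ Y (k * d) ω - Y 0 ω) u
      = charFun (P.map fun ω ↦ Y d ω - Y 0 ω) u ^ k := by
  have hmono : Monotone fun i : ℕ ↦ (i : ℝ) * d := fun i j hij ↦ by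
    simp only
    gcongr
  have hind := hY.indep.nat hmono
  have h := congrFun (iIndepFun.charFun_map_fun_finsetSum_eq_prod (P := P) (s := Finset.range k)
    (X := fun i ω ↦ Y ((i + 1 : ℕ) * d) ω - Y ((i : ℕ) * d) ω)
    (fun i _ ↦ ((hY.measurable _).sub (hY.measurable _)).aemeasurable)
    (hind.precomp (g := fun i : Finset.range k ↦ (i : ℕ)) Subtype.val_injective)) u
  have htel (ω : Ω) : ∑ i ∈ Finset.range k, (Y ((i + 1 : ℕ) * d) ω - Y ((i : ℕ) * d) ω)
      = Y (k * d) ω - Y 0 ω := by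
    rw [Finset.sum_range_sub (fun i : ℕ ↦ Y (i * d) ω)]
    simp
  simp_rw [htel] at h
  rw [h, Finset.prod_apply, Finset.prod_congr rfl (fun i _ ↦ ?_), Finset.prod_const,
    Finset.card_range]
  have hstep : ((i + 1 : ℕ) : ℝ) * d - (i : ℕ) * d = d := by push_cast; ring
  rw [hY.map_sub_eq, hstep]

variable [IsProbabilityMeasure P]

/-- The characteristic function of the increments of a Lévy process. -/
theorem charFun_sub (hY : IsTwoSidedLevyProcess P Y) {ψ : ℝ → ℂ} (hψ : Continuous ψ)
    (hψ0 : ψ 0 = 0) (h1 : ∀ u, charFun (P.map (Y 1)) u = Complex.exp (ψ u))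
    {s t : ℝ} (hst : s ≤ t) (u : ℝ) :
    charFun (P.map fun ω ↦ Y t ω - Y s ω) u = Complex.exp ((t - s : ℝ) * ψ u) := by
  rw [hY.map_sub_eq]
  obtain ⟨h, hh, rfl⟩ : ∃ h, 0 ≤ h ∧ t - s = h := ⟨_, sub_nonneg.2 hst, rfl⟩
  generalize t - s = h at hh
  have hmeas (r : ℝ) : Measurable fun ω ↦ Y r ω - Y 0 ω :=
    (hY.measurable r).sub (hY.measurable 0)
  -- The law over time `1 / (n + 1)` is a root of the law at time `1`. Its powers give the grid
  -- times, and right continuity gives all times `h ≥ 0`.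
  have hroot (n : ℕ) (v : ℝ) :
      charFun (P.map fun ω ↦ Y (1 / ((n : ℝ) + 1)) ω - Y 0 ω) v
        = Complex.exp (ψ v / (n + 1 : ℕ)) := by
    have := Measure.isProbabilityMeasure_map (μ := P) (hmeas (1 / ((n : ℝ) + 1))).aemeasurable
    refine eq_exp_div_of_pow_eq_exp (φ := charFun _) continuous_charFun hψ n.succ_ne_zero
      (fun w ↦ ?_) (x₀ := 0) (by rw [charFun_zero, probReal_univ]; rfl) hψ0 v
    rw [← hY.charFun_nat_mul (by positivity), ← h1 w]
    congr 1
    refine Measure.map_congr ?_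
    filter_upwards [hY.zero] with ω hω
    have h3 : ((n + 1 : ℕ) : ℝ) * (1 / ((n : ℝ) + 1)) = 1 := by
      push_cast
      field_simp
    simp only [h3, hω, sub_zero]
  have hgrid (n : ℕ) : charFun (P.map fun ω ↦ Y (ceilGrid n h) ω - Y 0 ω) u
      = Complex.exp (ceilGrid n h * ψ u) := by
    have h0 : 0 ≤ ⌈h * (n + 1)⌉ := Int.ceil_nonneg (by positivity)
    obtain ⟨k, hk⟩ := Int.eq_ofNat_of_zero_le h0
    have h2 : ceilGrid n h = k * (1 / ((n : ℝ) + 1)) := by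
      rw [ceilGrid, hk]
      simp [div_eq_mul_inv]
    rw [h2, hY.charFun_nat_mul (by positivity), hroot, ← Complex.exp_nat_mul]
    congr 1
    push_cast
    ring
  have hlim : Tendsto (fun n ↦ charFun (P.map fun ω ↦ Y (ceilGrid n h) ω - Y 0 ω) u) atTop
      (𝓝 (charFun (P.map fun ω ↦ Y h ω - Y 0 ω) u)) := by
    refine tendsto_charFun_map_of_ae_tendsto (fun n ↦ (hmeas _).aemeasurable) ?_ u
    filter_upwards [hY.cadlag] with ω hω
    exact (tendsto_comp_ceilGrid (hω h).1).sub_const _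
  refine tendsto_nhds_unique hlim ?_
  simp_rw [hgrid]
  have hc : Continuous fun r : ℝ ↦ Complex.exp (r * ψ u) := by fun_prop
  exact (hc.tendsto h).comp (tendsto_ceilGrid h)

/-- The characteristic function of a weighted sum of increments of a Lévy process. -/
theorem charFun_sum_increments (hY : IsTwoSidedLevyProcess P Y) {ψ : ℝ → ℂ} (hψ : Continuous ψ)
    (hψ0 : ψ 0 = 0) (h1 : ∀ u, charFun (P.map (Y 1)) u = Complex.exp (ψ u))
    {τ : ℕ → ℝ} (hτ : Monotone τ) (c : ℕ → ℝ) (N : ℕ) :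
    charFun (P.map fun ω ↦ ∑ i ∈ Finset.range N, c i * (Y (τ (i + 1)) ω - Y (τ i) ω)) 1
      = Complex.exp (∑ i ∈ Finset.range N, (τ (i + 1) - τ i : ℝ) * ψ (c i)) := by
  have hmeas (i : ℕ) : Measurable fun ω ↦ Y (τ (i + 1)) ω - Y (τ i) ω :=
    (hY.measurable _).sub (hY.measurable _)
  have hind := (hY.indep.nat hτ).comp (fun i x ↦ c i * x) (fun i ↦ by fun_prop)
  have h := congrFun (iIndepFun.charFun_map_fun_finsetSum_eq_prod (P := P) (s := Finset.range N)
    (X := fun i ω ↦ c i * (Y (τ (i + 1)) ω - Y (τ i) ω))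
    (fun i _ ↦ ((hmeas i).const_mul (c i)).aemeasurable)
    (hind.precomp (g := fun i : Finset.range N ↦ (i : ℕ)) Subtype.val_injective)) 1
  rw [h, Finset.prod_apply, Complex.exp_sum]
  refine Finset.prod_congr rfl fun i _ ↦ ?_
  have h2 := charFun_map_mul_comp (μ := P) (hmeas i).aemeasurable (c i) 1
  rw [mul_one, hY.charFun_sub hψ hψ0 h1 (hτ i.le_succ)] at h2
  exact h2

end IsTwoSidedLevyProcess

end Increments

/-! ### Riemann sums along càdlàg paths and along the exponent. -/

section RiemannSums

/-- The `i`-th point of the grid of mesh `1 / (n + 1)` starting at the integer `A`. -/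
def gridPoint (A : ℤ) (n i : ℕ) : ℝ := A + i / ((n : ℝ) + 1)

lemma gridPoint_succ_sub (A : ℤ) (n i : ℕ) :
    gridPoint A n (i + 1) - gridPoint A n i = 1 / ((n : ℝ) + 1) := by
  unfold gridPoint
  push_cast
  ring

lemma strictMono_gridPoint (A : ℤ) (n : ℕ) : StrictMono (gridPoint A n) := by
  refine strictMono_nat_of_lt_succ fun i ↦ ?_
  have h := gridPoint_succ_sub A n i
  have : 0 < 1 / ((n : ℝ) + 1) := by positivity
  linarith

lemma gridPoint_zero (A : ℤ) (n : ℕ) : gridPoint A n 0 = A := by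
  simp [gridPoint]

lemma gridPoint_mul_succ (A : ℤ) (n L : ℕ) : gridPoint A n (L * (n + 1)) = A + L := by
  have : (n : ℝ) + 1 ≠ 0 := by positivity
  unfold gridPoint
  push_cast
  field_simp

lemma gridPoint_eq_div (A : ℤ) (n i : ℕ) :
    gridPoint A n i = ((A * (n + 1) + i : ℤ) : ℝ) / ((n : ℝ) + 1) := by
  have : (n : ℝ) + 1 ≠ 0 := by positivity
  unfold gridPoint
  push_cast
  field_simp

lemma ceilGrid_eq_gridPoint {A : ℤ} {n i : ℕ} {s : ℝ}
    (hs : s ∈ Set.Ioc (gridPoint A n i) (gridPoint A n (i + 1))) :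
    ceilGrid n s = gridPoint A n (i + 1) := by
  have hn : (0 : ℝ) < n + 1 := by positivity
  have h : ⌈s * (n + 1)⌉ = A * (n + 1) + (i + 1 : ℕ) := by
    rw [gridPoint_eq_div, gridPoint_eq_div, Set.mem_Ioc, div_lt_iff₀ hn, le_div_iff₀ hn] at hs
    rw [Int.ceil_eq_iff]
    refine ⟨?_, hs.2⟩
    have := hs.1
    push_cast at this ⊢
    linarith
  rw [gridPoint_eq_div, ceilGrid, h]

/-- The equivalence converts the indicator of `[a, b)` at grid points into an interval of indices.
-/
lemma exists_gridPoint_eq_ceilGrid {A : ℤ} (n : ℕ) {a : ℝ} (ha : A ≤ a) :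
    ∃ k : ℕ, gridPoint A n k = ceilGrid n a ∧ ∀ i, a ≤ gridPoint A n i ↔ k ≤ i := by
  have hn : (0 : ℝ) < n + 1 := by positivity
  have h0 : A * (n + 1) ≤ ⌈a * (n + 1)⌉ := by
    have h1 : ((A * (n + 1) : ℤ) : ℝ) ≤ ⌈a * (n + 1)⌉ := by
      refine le_trans ?_ (Int.le_ceil _)
      push_cast
      gcongr
    exact_mod_cast h1
  obtain ⟨k, hk⟩ := Int.eq_ofNat_of_zero_le (sub_nonneg.2 h0)
  have hk' : ⌈a * (n + 1)⌉ = A * (n + 1) + k := by omega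
  refine ⟨k, by rw [gridPoint_eq_div, ceilGrid, hk'], fun i ↦ ?_⟩
  rw [gridPoint_eq_div, le_div_iff₀ hn, ← Int.ceil_le, hk']
  omega

lemma intervalIntegrable_comp_ceilGrid_mul {g : ℝ → ℝ} (hg : Continuous g) (y : ℝ → ℝ)
    (A : ℤ) (n i : ℕ) :
    IntervalIntegrable (fun s ↦ y (ceilGrid n s) * g s) volume
      (gridPoint A n i) (gridPoint A n (i + 1)) := by
  refine IntervalIntegrable.congr (f := fun s ↦ y (gridPoint A n (i + 1)) * g s) ?_
    ((by fun_prop : Continuous fun s ↦ y (gridPoint A n (i + 1)) * g s).intervalIntegrable _ _)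
  intro s hs
  rw [Set.uIoc_of_le (strictMono_gridPoint A n i.lt_succ_self).le] at hs
  simp only [ceilGrid_eq_gridPoint hs]

/-- Abel summation, with no error term: on a left-open grid cell `ceilGrid` is constantly the right
endpoint, so each summand `y(right) (g(right) - g(left))` is an integral over the cell. -/
lemma sum_indicator_mul_sub_eq {g g' : ℝ → ℝ} (hg : ∀ s, HasDerivAt g (g' s) s)
    (hg' : Continuous g') (y : ℝ → ℝ) {A : ℤ} {L : ℕ} (n : ℕ) {a b : ℝ} (hAa : A ≤ a)
    (hab : a ≤ b) (hbL : b ≤ A + L) :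
    ∑ i ∈ Finset.range (L * (n + 1)), (Set.Ico a b).indicator g (gridPoint A n i) *
        (y (gridPoint A n (i + 1)) - y (gridPoint A n i))
      = g (ceilGrid n b) * y (ceilGrid n b) - g (ceilGrid n a) * y (ceilGrid n a)
        - ∫ s in ceilGrid n a..ceilGrid n b, y (ceilGrid n s) * g' s := by
  obtain ⟨k, hk, hk'⟩ := exists_gridPoint_eq_ceilGrid n hAa
  obtain ⟨l, hl, hl'⟩ := exists_gridPoint_eq_ceilGrid n (hAa.trans hab)
  have hkl : k ≤ l := (hk' l).1 (hab.trans ((hl' l).2 le_rfl))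
  have hlN : l ≤ L * (n + 1) := (hl' _).1 (by rwa [gridPoint_mul_succ])
  have hsub : Finset.Ico k l ⊆ Finset.range (L * (n + 1)) := fun i hi ↦ by
    rw [Finset.mem_Ico] at hi
    exact Finset.mem_range.2 (by omega)
  rw [← Finset.sum_subset hsub]
  · rw [← hk, ← hl, ← intervalIntegral.sum_integral_adjacent_intervals_Ico hkl
      (fun i _ ↦ intervalIntegrable_comp_ceilGrid_mul hg' y A n i),
      ← Finset.sum_Ico_sub (fun i ↦ g (gridPoint A n i) * y (gridPoint A n i)) hkl,
      ← Finset.sum_sub_distrib]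
    refine Finset.sum_congr rfl fun i hi ↦ ?_
    rw [Finset.mem_Ico] at hi
    have hmem : gridPoint A n i ∈ Set.Ico a b :=
      ⟨(hk' i).2 hi.1, lt_of_not_ge fun h ↦ absurd ((hl' i).1 h) (by omega)⟩
    have hint : ∫ s in gridPoint A n i..gridPoint A n (i + 1), y (ceilGrid n s) * g' s
        = y (gridPoint A n (i + 1)) * (g (gridPoint A n (i + 1)) - g (gridPoint A n i)) := by
      rw [← intervalIntegral.integral_eq_sub_of_hasDerivAt (fun s _ ↦ hg s)
        (hg'.intervalIntegrable _ _), ← intervalIntegral.integral_const_mul]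
      refine intervalIntegral.integral_congr_ae (Eventually.of_forall fun s hs ↦ ?_)
      rw [Set.uIoc_of_le (strictMono_gridPoint A n i.lt_succ_self).le] at hs
      rw [ceilGrid_eq_gridPoint hs]
    rw [hint, Set.indicator_of_mem hmem]
    ring
  · intro i _ hi
    rw [Set.indicator_of_notMem, zero_mul]
    rintro ⟨h1, h2⟩
    refine hi (Finset.mem_Ico.2 ⟨(hk' i).1 h1, ?_⟩)
    by_contra hcon
    exact absurd ((hl' i).2 (by omega)) (not_le.2 h2)

/-- Dominated convergence on `[a, b + 1]`, which contains all rounded intervals. Rounding its points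
once more reaches `b + 2`, whence the range of the bound on `y`. -/
lemma tendsto_intervalIntegral_comp_ceilGrid {y g' : ℝ → ℝ} (hg' : Continuous g')
    (hy : ∀ s, ContinuousWithinAt y (Set.Ici s) s) {a b M : ℝ} (hab : a ≤ b)
    (hM : ∀ s ∈ Set.Icc a (b + 2), |y s| ≤ M) :
    Tendsto (fun n ↦ ∫ s in ceilGrid n a..ceilGrid n b, y (ceilGrid n s) * g' s) atTop
      (𝓝 (∫ s in a..b, y s * g' s)) := by
  have hmono (n : ℕ) : ceilGrid n a ≤ ceilGrid n b := by
    unfold ceilGrid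
    gcongr
  have hind (n : ℕ) : ∫ s in ceilGrid n a..ceilGrid n b, y (ceilGrid n s) * g' s
      = ∫ s, (Set.Ioc (ceilGrid n a) (ceilGrid n b)).indicator
        (fun s ↦ y (ceilGrid n s) * g' s) s := by
    rw [intervalIntegral.integral_of_le (hmono n), integral_indicator measurableSet_Ioc]
  simp_rw [hind]
  rw [intervalIntegral.integral_of_le hab, ← integral_indicator measurableSet_Ioc]
  refine tendsto_integral_of_dominated_convergence
    ((Set.Icc a (b + 1)).indicator fun s ↦ M * |g' s|) (fun n ↦ ?_) ?_ (fun n ↦ ?_) ?_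
  · exact (((measurable_comp_ceilGrid y n).mul hg'.measurable).indicator
      measurableSet_Ioc).aestronglyMeasurable
  · rw [integrable_indicator_iff measurableSet_Icc]
    exact (by fun_prop : Continuous fun s ↦ M * |g' s|).continuousOn.integrableOn_Icc
  · refine Eventually.of_forall fun s ↦ ?_
    by_cases hs : s ∈ Set.Ioc (ceilGrid n a) (ceilGrid n b)
    · have hs' : s ∈ Set.Icc a (b + 1) :=
        ⟨(le_ceilGrid n a).trans hs.1.le, hs.2.trans (ceilGrid_le_add_one n b)⟩
      rw [Set.indicator_of_mem hs, Set.indicator_of_mem hs', norm_mul, Real.norm_eq_abs,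
        Real.norm_eq_abs]
      gcongr
      refine hM _ ⟨hs'.1.trans (le_ceilGrid n s), ?_⟩
      linarith [ceilGrid_le_add_one n s, hs'.2]
    · rw [Set.indicator_of_notMem hs, norm_zero]
      refine Set.indicator_nonneg (fun r _ ↦ ?_) s
      have : 0 ≤ M := (abs_nonneg _).trans (hM a ⟨le_rfl, by linarith⟩)
      positivity
  · refine Eventually.of_forall fun s ↦ ?_
    by_cases hs : s ∈ Set.Ioc a b
    · rw [Set.indicator_of_mem hs]
      have h1 : Tendsto (fun n ↦ y (ceilGrid n s) * g' s) atTop (𝓝 (y s * g' s)) :=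
        (tendsto_comp_ceilGrid (hy s)).mul_const _
      refine h1.congr' ?_
      filter_upwards [(tendsto_ceilGrid a).eventually_lt_const hs.1] with n hn
      rw [Set.indicator_of_mem
        (show s ∈ Set.Ioc (ceilGrid n a) (ceilGrid n b) from ⟨hn, hs.2.trans (le_ceilGrid n b)⟩)]
    · rw [Set.indicator_of_notMem hs]
      refine tendsto_const_nhds.congr' ?_
      rcases le_or_gt s a with h | h
      · refine Eventually.of_forall fun n ↦ ?_
        beta_reduce
        rw [Set.indicator_of_notMem]
        exact fun hmem ↦ absurd hmem.1 (not_lt.2 (h.trans (le_ceilGrid n a)))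
      · have hbs : b < s := lt_of_not_ge fun hsb ↦ hs ⟨h, hsb⟩
        filter_upwards [(tendsto_ceilGrid b).eventually_lt_const hbs] with n hn
        rw [Set.indicator_of_notMem]
        exact fun hmem ↦ absurd hmem.2 (not_le.2 hn)

lemma tendsto_sum_gridPoint_integral {Φ : ℝ → ℂ} {M : ℝ} (hM : ∀ s, ‖Φ s‖ ≤ M)
    (hΦ : ∀ s, ContinuousWithinAt Φ (Set.Ici s) s) {A : ℤ} {L : ℕ} (h0 : Φ A = 0)
    (hL : Φ (A + L) = 0) :
    Tendsto (fun n ↦ ∑ i ∈ Finset.range (L * (n + 1)),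
      ((gridPoint A n (i + 1) - gridPoint A n i : ℝ) : ℂ) * Φ (gridPoint A n i)) atTop
      (𝓝 (∫ s in (A : ℝ)..A + L, Φ s)) := by
  have hsum (n : ℕ) : ∑ i ∈ Finset.range (L * (n + 1)),
      ((gridPoint A n (i + 1) - gridPoint A n i : ℝ) : ℂ) * Φ (gridPoint A n i)
      = ∫ s in (A : ℝ)..A + L, Φ (ceilGrid n s) := by
    have hstep (i : ℕ) : ∀ s ∈ Set.uIoc (gridPoint A n i) (gridPoint A n (i + 1)),
        Φ (gridPoint A n (i + 1)) = Φ (ceilGrid n s) := fun s hs ↦ by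
      rw [Set.uIoc_of_le (strictMono_gridPoint A n i.lt_succ_self).le] at hs
      rw [ceilGrid_eq_gridPoint hs]
    rw [← gridPoint_mul_succ A n L, ← gridPoint_zero A n,
      ← intervalIntegral.sum_integral_adjacent_intervals (fun i _ ↦
        IntervalIntegrable.congr (hstep i) intervalIntegrable_const)]
    -- The sum samples left endpoints, as independence of increments dictates, while `ceilGrid`
    -- samples right ones. The shift costs nothing because `Φ` vanishes at both ends.
    have hshift : ∑ i ∈ Finset.range (L * (n + 1)), Φ (gridPoint A n i)
        = ∑ i ∈ Finset.range (L * (n + 1)), Φ (gridPoint A n (i + 1)) := by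
      have h1 := Finset.sum_range_sub (fun i ↦ Φ (gridPoint A n i)) (L * (n + 1))
      rw [gridPoint_mul_succ, gridPoint_zero, h0, hL, sub_zero, Finset.sum_sub_distrib,
        sub_eq_zero] at h1
      exact h1.symm
    simp_rw [gridPoint_succ_sub]
    rw [← Finset.mul_sum, hshift, Finset.mul_sum]
    refine Finset.sum_congr rfl fun i _ ↦ ?_
    rw [intervalIntegral.integral_congr_ae (g := fun _ ↦ Φ (gridPoint A n (i + 1)))
      (Eventually.of_forall fun s hs ↦ (hstep i s hs).symm), intervalIntegral.integral_const,
      gridPoint_succ_sub, Complex.real_smul]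
  simp_rw [hsum]
  refine intervalIntegral.tendsto_integral_filter_of_dominated_convergence (fun _ ↦ M)
    (Eventually.of_forall fun n ↦ (measurable_comp_ceilGrid Φ n).aestronglyMeasurable)
    (Eventually.of_forall fun n ↦ Eventually.of_forall fun s _ ↦ hM _) intervalIntegrable_const
    (Eventually.of_forall fun s _ ↦ tendsto_comp_ceilGrid (hΦ s))

lemma continuousWithinAt_Ici_indicator_Ico {g : ℝ → ℝ} (hg : Continuous g) (a b s : ℝ) :
    ContinuousWithinAt ((Set.Ico a b).indicator g) (Set.Ici s) s := by
  rcases lt_or_ge s a with h | h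
  · have : (Set.Ico a b).indicator g =ᶠ[𝓝 s] fun _ ↦ 0 := by
      filter_upwards [Iio_mem_nhds h] with r hr
      exact Set.indicator_of_notMem (fun hm ↦ absurd hm.1 (not_le.2 hr)) _
    exact (continuousAt_const.congr this.symm).continuousWithinAt
  rcases lt_or_ge s b with h' | h'
  · have : (Set.Ico a b).indicator g =ᶠ[𝓝[Set.Ici s] s] g := by
      filter_upwards [mem_nhdsWithin_of_mem_nhds (Iio_mem_nhds h'), self_mem_nhdsWithin]
        with r hr hr'
      exact Set.indicator_of_mem (show r ∈ Set.Ico a b from ⟨le_trans h hr', hr⟩) _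
    exact hg.continuousWithinAt.congr_of_eventuallyEq this
      (Set.indicator_of_mem (show s ∈ Set.Ico a b from ⟨h, h'⟩) _)
  · have (r : ℝ) (hr : s ≤ r) : (Set.Ico a b).indicator g r = 0 :=
      Set.indicator_of_notMem (fun hm ↦ absurd hm.2 (not_lt.2 (h'.trans hr))) _
    exact continuousWithinAt_const.congr (fun r hr ↦ this r hr) (this s le_rfl)

end RiemannSums

/-- One-sided limits bound `y` near every point, and compactness makes the bound uniform. -/
lemma exists_forall_abs_le_of_cadlag {y : ℝ → ℝ}
    (hy : ∀ s : ℝ, ContinuousWithinAt y (Set.Ici s) s ∧ ∃ l : ℝ, Tendsto y (𝓝[<] s) (𝓝 l))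
    (a b : ℝ) : ∃ M, ∀ s ∈ Set.Icc a b, |y s| ≤ M := by
  refine isCompact_Icc.induction_on (p := fun S ↦ ∃ M, ∀ s ∈ S, |y s| ≤ M) ⟨0, by simp⟩
    (fun S T hST ⟨M, hM⟩ ↦ ⟨M, fun s hs ↦ hM s (hST hs)⟩) ?_ fun s _ ↦ ?_
  · rintro S T ⟨M, hM⟩ ⟨M', hM'⟩
    refine ⟨max M M', ?_⟩
    rintro s (hs | hs)
    exacts [(hM s hs).trans (le_max_left _ _), (hM' s hs).trans (le_max_right _ _)]
  · obtain ⟨hr, l, hl⟩ := hy s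
    have h1 : ∀ᶠ r in 𝓝[≥] s, |y r| ≤ |y s| + 1 :=
      (hr.tendsto.abs.eventually_lt_const (lt_add_one _)).mono fun r h ↦ h.le
    have h2 : ∀ᶠ r in 𝓝[<] s, |y r| ≤ |l| + 1 :=
      (hl.abs.eventually_lt_const (lt_add_one _)).mono fun r h ↦ h.le
    refine ⟨{r | |y r| ≤ max (|y s| + 1) (|l| + 1)}, mem_nhdsWithin_of_mem_nhds ?_, _,
      fun r hr ↦ hr⟩
    rw [← nhdsLT_sup_nhdsGE s]
    exact mem_sup.2 ⟨h2.mono fun r h ↦ h.trans (le_max_right _ _),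
      h1.mono fun r h ↦ h.trans (le_max_left _ _)⟩

lemma hasDerivAt_exp_neg (s : ℝ) : HasDerivAt (fun s ↦ Real.exp (-s)) (-Real.exp (-s)) s := by
  simpa using (hasDerivAt_neg s).exp

lemma pathIntegral_exp_neg (y : ℝ → ℝ) (a b : ℝ) :
    pathIntegral (fun s ↦ Real.exp (-s)) y a b
      = Real.exp (-b) * y b - Real.exp (-a) * y a - ∫ s in a..b, y s * -Real.exp (-s) := by
  have : deriv (fun s ↦ Real.exp (-s)) = fun s ↦ -Real.exp (-s) :=
    funext fun s ↦ (hasDerivAt_exp_neg s).deriv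
  rw [pathIntegral, this]

/-- Riemann sums converge to the pathwise integral of `e^{-s}` against a càdlàg path. -/
lemma tendsto_riemannSum_pathIntegral {y : ℝ → ℝ}
    (hy : ∀ s : ℝ, ContinuousWithinAt y (Set.Ici s) s ∧ ∃ l : ℝ, Tendsto y (𝓝[<] s) (𝓝 l))
    {A : ℤ} {L : ℕ} {a b : ℝ} (hAa : A ≤ a) (hab : a ≤ b) (hbL : b ≤ A + L) :
    Tendsto (fun n ↦ ∑ i ∈ Finset.range (L * (n + 1)),
      (Set.Ico a b).indicator (fun s ↦ Real.exp (-s)) (gridPoint A n i) *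
        (y (gridPoint A n (i + 1)) - y (gridPoint A n i))) atTop
      (𝓝 (pathIntegral (fun s ↦ Real.exp (-s)) y a b)) := by
  have hc : Continuous fun s : ℝ ↦ -Real.exp (-s) := by fun_prop
  have hright (s : ℝ) := (hy s).1
  obtain ⟨M, hM⟩ := exists_forall_abs_le_of_cadlag hy a (b + 2)
  simp_rw [sum_indicator_mul_sub_eq hasDerivAt_exp_neg hc y _ hAa hab hbL]
  rw [pathIntegral_exp_neg]
  have hF (s : ℝ) : Tendsto (fun n ↦ Real.exp (-ceilGrid n s) * y (ceilGrid n s)) atTop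
      (𝓝 (Real.exp (-s) * y s)) :=
    (((by fun_prop : Continuous fun s : ℝ ↦ Real.exp (-s)).tendsto s).comp
      (tendsto_ceilGrid s)).mul (tendsto_comp_ceilGrid (hright s))
  exact ((hF b).sub (hF a)).sub (tendsto_intervalIntegral_comp_ceilGrid hc hright hab hM)

/-! ### Laws of integrals over bounded intervals. -/

section PathIntegral

variable {Ω : Type*} [MeasurableSpace Ω] {P : Measure Ω} {Y : ℝ → Ω → ℝ}

namespace IsTwoSidedLevyProcess

lemma aemeasurable_pathIntegral (hY : IsTwoSidedLevyProcess P Y) {a b : ℝ} (hab : a ≤ b) :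
    AEMeasurable (fun ω ↦ pathIntegral (fun s ↦ Real.exp (-s)) (fun s ↦ Y s ω) a b) P := by
  refine aemeasurable_of_tendsto_metrizable_ae atTop (f := fun n ω ↦
    ∑ i ∈ Finset.range (⌈b - ⌊a⌋⌉₊ * (n + 1)),
      (Set.Ico a b).indicator (fun s ↦ Real.exp (-s)) (gridPoint ⌊a⌋ n i) *
        (Y (gridPoint ⌊a⌋ n (i + 1)) ω - Y (gridPoint ⌊a⌋ n i) ω)) (fun n ↦ ?_) ?_
  · exact (Finset.measurable_fun_sum _ fun i _ ↦
      ((hY.measurable _).sub (hY.measurable _)).const_mul _).aemeasurable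
  · filter_upwards [hY.cadlag] with ω hω
    refine tendsto_riemannSum_pathIntegral hω (Int.floor_le a) hab ?_
    linarith [Nat.le_ceil (b - ⌊a⌋)]

/-- The joint characteristic function of integrals of `e^{-s}` against a Lévy process. -/
theorem charFun_sum_pathIntegral [IsProbabilityMeasure P] (hY : IsTwoSidedLevyProcess P Y)
    {ψ : ℝ → ℂ} (hψ : Continuous ψ)
    (hψ0 : ψ 0 = 0) (h1 : ∀ u, charFun (P.map (Y 1)) u = Complex.exp (ψ u))
    {ι : Type*} (I : Finset ι) (a u : ι → ℝ) {b : ℝ} (hab : ∀ j ∈ I, a j ≤ b) :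
    charFun (P.map fun ω ↦ ∑ j ∈ I,
      u j * pathIntegral (fun s ↦ Real.exp (-s)) (fun s ↦ Y s ω) (a j) b) 1
      = Complex.exp (∫ s, ψ (∑ j ∈ I,
        u j * (Set.Ico (a j) b).indicator (fun s ↦ Real.exp (-s)) s)) := by
  classical
  -- `A` lies strictly below every `a j`, so that the combined kernel `h` already vanishes at the
  -- left end of the grid.
  obtain ⟨A, hA, hAb⟩ : ∃ A : ℤ, (∀ j ∈ I, (A : ℝ) < a j) ∧ (A : ℝ) < b := by
    obtain ⟨c, hc⟩ := (insert b (I.image a)).bddBelow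
    obtain ⟨A, hA⟩ := exists_int_lt c
    exact ⟨A, fun j hj ↦ hA.trans_le (hc (by
      simp only [Finset.coe_insert, Finset.coe_image]
      exact Or.inr ⟨j, hj, rfl⟩)), hA.trans_le (hc (by simp))⟩
  set L : ℕ := ⌈b - A⌉₊
  have hL : b ≤ A + L := by linarith [Nat.le_ceil (b - A)]
  set h : ℝ → ℝ := fun s ↦ ∑ j ∈ I, u j * (Set.Ico (a j) b).indicator (fun s ↦ Real.exp (-s)) s
  have hzero (s : ℝ) (hs : s ≤ A ∨ b ≤ s) : h s = 0 := by
    refine Finset.sum_eq_zero fun j hj ↦ ?_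
    rw [Set.indicator_of_notMem, mul_zero]
    rintro ⟨h2, h3⟩
    rcases hs with hs | hs
    · linarith [hA j hj]
    · linarith
  have hbound (s : ℝ) : |h s| ≤ ∑ j ∈ I, |u j| * Real.exp (-A) := by
    refine (Finset.abs_sum_le_sum_abs _ _).trans (Finset.sum_le_sum fun j hj ↦ ?_)
    rw [abs_mul]
    gcongr
    rw [abs_of_nonneg (Set.indicator_nonneg (fun _ _ ↦ (Real.exp_pos _).le) _)]
    refine Set.indicator_le' (fun r hr ↦ ?_) (fun r _ ↦ (Real.exp_pos _).le) s
    exact Real.exp_le_exp.2 (by linarith [hA j hj, hr.1])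
  have hright (s : ℝ) : ContinuousWithinAt h (Set.Ici s) s := by
    refine tendsto_finsetSum I fun j _ ↦ Tendsto.const_mul _ ?_
    exact continuousWithinAt_Ici_indicator_Ico (by fun_prop) (a j) b s
  obtain ⟨M, hM⟩ := (isCompact_Icc (a := -∑ j ∈ I, |u j| * Real.exp (-A))
    (b := ∑ j ∈ I, |u j| * Real.exp (-A))).exists_bound_of_continuousOn hψ.continuousOn
  have hexp := tendsto_sum_gridPoint_integral (Φ := fun s ↦ ψ (h s)) (A := A) (L := L)
    (fun s ↦ hM _ (abs_le.1 (hbound s))) (fun s ↦ hψ.continuousAt.comp_continuousWithinAt (hright s))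
    (by simp only [hzero A (Or.inl le_rfl), hψ0]) (by simp only [hzero _ (Or.inr hL), hψ0])
  have hsupp : Function.support (fun s ↦ ψ (h s)) ⊆ Set.Ioc A (A + L) := by
    intro s hs
    by_contra hcon
    refine hs ?_
    simp only
    rw [hzero s, hψ0]
    by_contra hcon'
    push Not at hcon'
    exact hcon ⟨hcon'.1, by linarith⟩
  rw [intervalIntegral.integral_eq_integral_of_support_subset hsupp] at hexp
  have hV (n : ℕ) : AEMeasurable (fun ω ↦ ∑ i ∈ Finset.range (L * (n + 1)),
      h (gridPoint A n i) * (Y (gridPoint A n (i + 1)) ω - Y (gridPoint A n i) ω)) P :=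
    (Finset.measurable_fun_sum _ fun i _ ↦
      ((hY.measurable _).sub (hY.measurable _)).const_mul _).aemeasurable
  -- The combination of the path integrals is the limit of the sums of increments weighted by `h`,
  -- after exchanging the two finite sums.
  have hlim := tendsto_charFun_map_of_ae_tendsto (W := fun ω ↦ ∑ j ∈ I,
      u j * pathIntegral (fun s ↦ Real.exp (-s)) (fun s ↦ Y s ω) (a j) b) hV (by
    filter_upwards [hY.cadlag] with ω hω
    have := tendsto_finsetSum I fun j hj ↦ (tendsto_riemannSum_pathIntegral hω (hA j hj).le
      (hab j hj) hL).const_mul (u j)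
    refine this.congr fun n ↦ ?_
    simp_rw [Finset.mul_sum, h, Finset.sum_mul]
    rw [Finset.sum_comm]
    simp_rw [mul_assoc]) 1
  simp_rw [hY.charFun_sum_increments hψ hψ0 h1 (strictMono_gridPoint A _).monotone] at hlim
  exact tendsto_nhds_unique hlim ((Complex.continuous_exp.tendsto _).comp hexp)

end IsTwoSidedLevyProcess

end PathIntegral

/-! ### A maximal inequality for sums of independent variables. -/

section Ottaviani

variable {Ω : Type*} [MeasurableSpace Ω] {P : Measure Ω}

/-- Ottaviani's maximal inequality. -/
theorem measure_exists_lt_abs_sum_le {D : ℕ → Ω → ℝ} (hind : iIndepFun D P)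
    (hmeas : ∀ i, Measurable (D i)) {N : ℕ} {α β : ℝ}
    (h : ∀ k ≤ N, 1 ≤ 2 * P {ω | |∑ i ∈ Finset.Ico k N, D i ω| ≤ β}) :
    P {ω | ∃ k ≤ N, α + β < |∑ i ∈ Finset.range k, D i ω|}
      ≤ 2 * P {ω | α < |∑ i ∈ Finset.range N, D i ω|} := by
  -- First passage above `α + β` happens at `k`. This depends only on `D 0, …, D (k - 1)`, hence is
  -- independent of the remaining sum in `B k`.
  let A (k : ℕ) : Set Ω := {ω | α + β < |∑ i ∈ Finset.range k, D i ω| ∧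
    ∀ j < k, |∑ i ∈ Finset.range j, D i ω| ≤ α + β}
  let B (k : ℕ) : Set Ω := {ω | |∑ i ∈ Finset.Ico k N, D i ω| ≤ β}
  have hSm (s : Finset ℕ) : Measurable fun ω ↦ ∑ i ∈ s, D i ω :=
    Finset.measurable_fun_sum _ fun i _ ↦ hmeas i
  have hA (k : ℕ) : MeasurableSet (A k) := by
    have hAk : A k = {ω | α + β < |∑ i ∈ Finset.range k, D i ω|} ∩
        ⋂ j, ⋂ (_ : j < k), {ω | |∑ i ∈ Finset.range j, D i ω| ≤ α + β} := by
      ext ω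
      simp [A]
    rw [hAk]
    exact (measurableSet_lt measurable_const (hSm _).abs).inter <|
      MeasurableSet.iInter fun j ↦ MeasurableSet.iInter fun _ ↦
        measurableSet_le (hSm _).abs measurable_const
  have hB (k : ℕ) : MeasurableSet (B k) := measurableSet_le (hSm _).abs measurable_const
  have hAB (k : ℕ) : P (A k ∩ B k) = P (A k) * P (B k) := by
    have hi := hind.indepFun_finset (Finset.range k) (Finset.Ico k N)
      (Finset.disjoint_left.2 fun i hi hi' ↦ by
        rw [Finset.mem_range] at hi
        rw [Finset.mem_Ico] at hi'
        omega) hmeas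
    -- Partial sums written as functions of the vector of the first `k` variables, to express `A k`
    -- through that vector.
    let σ (j : ℕ) (x : Finset.range k → ℝ) : ℝ :=
      ∑ i : Finset.range k, if (i : ℕ) < j then x i else 0
    have hσm (j : ℕ) : Measurable (σ j) :=
      Finset.measurable_fun_sum _ fun i _ ↦ by split_ifs <;> fun_prop
    have hσ {j : ℕ} (hj : j ≤ k) (ω : Ω) :
        σ j (fun i ↦ D i ω) = ∑ i ∈ Finset.range j, D i ω := by
      simp only [σ]
      rw [Finset.sum_coe_sort (Finset.range k) (fun i ↦ if i < j then D i ω else 0),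
        ← Finset.sum_filter]
      congr 1
      ext i
      simp only [Finset.mem_filter, Finset.mem_range]
      omega
    let A' : Set (Finset.range k → ℝ) := {x | α + β < |σ k x| ∧ ∀ j < k, |σ j x| ≤ α + β}
    let B' : Set (Finset.Ico k N → ℝ) := {x | |∑ i, x i| ≤ β}
    have hA' : MeasurableSet A' := by
      have hAk : A' = {x | α + β < |σ k x|} ∩ ⋂ j, ⋂ (_ : j < k), {x | |σ j x| ≤ α + β} := by
        ext x
        simp [A']
      rw [hAk]
      exact (measurableSet_lt measurable_const (hσm _).abs).inter <|
        MeasurableSet.iInter fun j ↦ MeasurableSet.iInter fun _ ↦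
          measurableSet_le (hσm _).abs measurable_const
    have hB' : MeasurableSet B' := measurableSet_le (by fun_prop) measurable_const
    have := hi.measure_inter_preimage_eq_mul A' B' hA' hB'
    have e1 : (fun ω (i : Finset.range k) ↦ D i ω) ⁻¹' A' = A k := by
      ext ω
      simp only [Set.mem_preimage, A', A, Set.mem_ofPred_eq, hσ le_rfl]
      exact and_congr_right fun _ ↦ forall₂_congr fun j hj ↦ by rw [hσ hj.le]
    have e2 : (fun ω (i : Finset.Ico k N) ↦ D i ω) ⁻¹' B' = B k := by
      ext ω
      simp only [Set.mem_preimage, B', B, Set.mem_ofPred_eq]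
      rw [Finset.sum_coe_sort (Finset.Ico k N) (fun i ↦ D i ω)]
    rwa [e1, e2] at this
  have hdisj : Set.PairwiseDisjoint (↑(Finset.range (N + 1))) fun k ↦ A k ∩ B k := by
    intro k _ l _ hkl
    refine Set.disjoint_left.2 fun ω h1 h2 ↦ ?_
    rcases lt_or_gt_of_ne hkl with h' | h'
    · exact absurd (h2.1.2 k h') (not_le.2 h1.1.1)
    · exact absurd (h1.1.2 l h') (not_le.2 h2.1.1)
  calc P {ω | ∃ k ≤ N, α + β < |∑ i ∈ Finset.range k, D i ω|}
      ≤ P (⋃ k ∈ Finset.range (N + 1), A k) := by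
        refine measure_mono fun ω hω ↦ ?_
        have hex : ∃ k, α + β < |∑ i ∈ Finset.range k, D i ω| := hω.imp fun k hk ↦ hk.2
        obtain ⟨k, hk, hk'⟩ := hω
        classical
        simp only [Set.mem_iUnion, Finset.mem_range, exists_prop]
        refine ⟨Nat.find hex, ?_, Nat.find_spec hex, fun j hj ↦ not_lt.1 (Nat.find_min hex hj)⟩
        exact (Nat.find_min' hex hk').trans_lt (by omega)
    _ ≤ ∑ k ∈ Finset.range (N + 1), P (A k) := measure_biUnion_finset_le _ _
    _ ≤ ∑ k ∈ Finset.range (N + 1), 2 * P (A k ∩ B k) := by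
        refine Finset.sum_le_sum fun k hk ↦ ?_
        rw [hAB, mul_left_comm]
        exact le_mul_of_one_le_right zero_le
          (h k (by rw [Finset.mem_range] at hk; omega))
    _ = 2 * P (⋃ k ∈ Finset.range (N + 1), A k ∩ B k) := by
        rw [← Finset.mul_sum, measure_biUnion_finset hdisj fun k _ ↦ (hA k).inter (hB k)]
    _ ≤ 2 * P {ω | α < |∑ i ∈ Finset.range N, D i ω|} := by
        gcongr
        refine Set.iUnion₂_subset fun k hk ω hω ↦ ?_
        have h1 : α + β < |∑ i ∈ Finset.range k, D i ω| := hω.1.1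
        have h2 : |∑ i ∈ Finset.Ico k N, D i ω| ≤ β := hω.2
        have h3 := Finset.sum_range_add_sum_Ico (fun i ↦ D i ω)
          (show k ≤ N by rw [Finset.mem_range] at hk; omega)
        change α < |∑ i ∈ Finset.range N, D i ω|
        -- From a level above `α + β`, a remainder of size at most `β` leaves the total above `α`.
        have h4 := abs_sub (∑ i ∈ Finset.range N, D i ω) (∑ i ∈ Finset.Ico k N, D i ω)
        rw [← h3, add_sub_cancel_right, h3] at h4
        linarith

end Ottaviani

/-! ### Growth of the paths and convergence of the improper integrals. -/

section Growth

variable {Ω : Type*} [MeasurableSpace Ω] {P : Measure Ω} [IsProbabilityMeasure P]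
  {Y : ℝ → Ω → ℝ}

namespace IsTwoSidedLevyProcess

/-- Otherwise, for each `m`, some increment exceeds `m` with probability above `1/2`. The limsup of
these events would have probability at least `1/2`, although càdlàg paths are bounded on `[0, 1]`.
-/
lemma exists_measure_lt_abs_sub_le_half (hY : IsTwoSidedLevyProcess P Y) :
    ∃ β : ℝ, 0 ≤ β ∧ ∀ s ∈ Set.Icc (0 : ℝ) 1, P {ω | β < |Y 1 ω - Y s ω|} ≤ 1 / 2 := by
  by_contra! hcon
  choose! s hs hPs using fun m : ℕ ↦ hcon m m.cast_nonneg
  let C (n : ℕ) : Set Ω := ⋃ m ≥ n, {ω | (m : ℝ) < |Y 1 ω - Y (s m) ω|}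
  have hCm (n : ℕ) : MeasurableSet (C n) :=
    MeasurableSet.iUnion fun m ↦ MeasurableSet.iUnion fun _ ↦
      measurableSet_lt measurable_const ((hY.measurable _).sub (hY.measurable _)).abs
  have hCanti : Antitone C := fun i j hij ↦
    Set.biUnion_subset_biUnion_left fun m (hm : j ≤ m) ↦ hij.trans hm
  have hlim := tendsto_measure_iInter_atTop (μ := P) (fun n ↦ (hCm n).nullMeasurableSet) hCanti
    ⟨0, measure_ne_top _ _⟩
  have hzero : P (⋂ n, C n) = 0 := by
    have hae : ∀ᵐ ω ∂P, ω ∉ ⋂ n, C n := by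
      filter_upwards [hY.cadlag] with ω hω hmem
      obtain ⟨M, hM⟩ := exists_forall_abs_le_of_cadlag hω 0 1
      obtain ⟨n, hn⟩ := exists_nat_ge (M + M)
      have := Set.mem_iInter.1 hmem n
      simp only [C, Set.mem_iUnion, Set.mem_ofPred_eq] at this
      obtain ⟨m, hm, hlt⟩ := this
      have h1 := abs_sub (Y 1 ω) (Y (s m) ω)
      have h2 := hM 1 (by simp)
      have h3 := hM (s m) (hs m)
      have h4 : (n : ℝ) ≤ m := by exact_mod_cast hm
      linarith
    exact measure_eq_zero_iff_ae_notMem.2 hae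
  rw [hzero] at hlim
  have hge : (1 / 2 : ℝ≥0∞) ≤ 0 := ge_of_tendsto' hlim fun n ↦ (hPs n).le.trans
    (measure_mono (Set.subset_biUnion_of_mem (u := fun m : ℕ ↦ {ω | (m : ℝ) < |Y 1 ω - Y (s m) ω|})
      (show n ≥ n from le_rfl)))
  simp at hge

lemma measure_exists_lt_abs_sub_le (hY : IsTwoSidedLevyProcess P Y) {β : ℝ}
    (hβ : ∀ s ∈ Set.Icc (0 : ℝ) 1, P {ω | β < |Y 1 ω - Y s ω|} ≤ 1 / 2) (k : ℤ) (α : ℝ) :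
    P {ω | ∃ s ∈ Set.Icc (k : ℝ) (k + 1), α + β < |Y s ω - Y k ω|}
      ≤ 2 * P {ω | α < |Y 1 ω|} := by
  let E (n : ℕ) : Set Ω := {ω | ∃ i ≤ n + 1, α + β < |Y (gridPoint k n i) ω - Y k ω|}
  have hend (n : ℕ) : gridPoint k n (n + 1) = k + 1 := by
    simpa using gridPoint_mul_succ k n 1
  have hlaw (s t r c : ℝ) : P {ω | c < |Y (t + r) ω - Y (s + r) ω|}
      = P {ω | c < |Y t ω - Y s ω|} :=
    (hY.stationary s t r).measure_mem_eq (s := {x | c < |x|})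
      (measurableSet_lt measurable_const measurable_id.abs)
  have hE (n : ℕ) : P (E n) ≤ 2 * P {ω | α < |Y 1 ω|} := by
    have hmono := (strictMono_gridPoint k n).monotone
    have hsum (j : ℕ) (ω : Ω) : ∑ i ∈ Finset.range j,
        (Y (gridPoint k n (i + 1)) ω - Y (gridPoint k n i) ω) = Y (gridPoint k n j) ω - Y k ω := by
      rw [Finset.sum_range_sub (fun i ↦ Y (gridPoint k n i) ω), gridPoint_zero]
    have := measure_exists_lt_abs_sum_le (hY.indep.nat hmono)
      (fun i ↦ (hY.measurable _).sub (hY.measurable _)) (N := n + 1) (α := α) (β := β) ?_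
    · simp_rw [hsum, hend] at this
      refine this.trans_eq ?_
      have h1 := hlaw 0 1 k α
      rw [zero_add, add_comm] at h1
      rw [h1]
      congr 1
      refine measure_congr ?_
      filter_upwards [hY.zero] with ω hω
      change (α < |Y 1 ω - Y 0 ω|) = (α < |Y 1 ω|)
      rw [hω, sub_zero]
    · intro i hi
      have hsum' (ω : Ω) : ∑ j ∈ Finset.Ico i (n + 1),
          (Y (gridPoint k n (j + 1)) ω - Y (gridPoint k n j) ω)
          = Y (k + 1) ω - Y (gridPoint k n i) ω := by
        rw [Finset.sum_Ico_sub (fun j ↦ Y (gridPoint k n j) ω) hi, hend]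
      simp_rw [hsum']
      have hmem : gridPoint k n i - k ∈ Set.Icc (0 : ℝ) 1 := by
        have h1 := hmono (Nat.zero_le i)
        have h2 := hmono hi
        rw [gridPoint_zero] at h1
        rw [hend] at h2
        exact ⟨by linarith, by linarith⟩
      have h2 := hβ _ hmem
      rw [← hlaw _ 1 k, sub_add_cancel, add_comm 1] at h2
      have hcompl : {ω | |Y (k + 1) ω - Y (gridPoint k n i) ω| ≤ β}
          = {ω | β < |Y (k + 1) ω - Y (gridPoint k n i) ω|}ᶜ := by
        ext ω
        simp
      have hms : MeasurableSet {ω | β < |Y (k + 1) ω - Y (gridPoint k n i) ω|} :=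
        measurableSet_lt measurable_const ((hY.measurable _).sub (hY.measurable _)).abs
      rw [hcompl, prob_compl_eq_one_sub hms]
      calc (1 : ℝ≥0∞) = 2 * (1 - 1 / 2) := by
            rw [one_div, ENNReal.one_sub_inv_two, ENNReal.mul_inv_cancel (by simp) (by simp)]
        _ ≤ _ := by gcongr
  -- By right continuity a strict exceedance at `s` persists at the rounded times on all fine grids,
  -- so the event lies in the liminf of the grid events.
  have hsub : ∀ᵐ ω ∂P, (∃ s ∈ Set.Icc (k : ℝ) (k + 1), α + β < |Y s ω - Y k ω|) →
      ω ∈ ⋃ m, ⋂ n ≥ m, E n := by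
    filter_upwards [hY.cadlag] with ω hω
    rintro ⟨s, hs, hlt⟩
    have hlim := ((tendsto_comp_ceilGrid (hω s).1).sub_const (Y k ω)).abs
    obtain ⟨m, hm⟩ := eventually_atTop.1 (hlim.eventually_const_lt hlt)
    refine Set.mem_iUnion.2 ⟨m, Set.mem_iInter₂.2 fun n hn ↦ ?_⟩
    obtain ⟨i, hi, hi'⟩ := exists_gridPoint_eq_ceilGrid n hs.1
    exact ⟨i, (hi' _).1 (by rw [hend]; exact hs.2), by rw [hi]; exact hm n hn⟩
  refine (measure_mono_ae (t := ⋃ m, ⋂ n ≥ m, E n) hsub).trans ?_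
  have hmonoU : Monotone fun m ↦ ⋂ n ≥ m, E n := fun i j hij ↦
    Set.biInter_subset_biInter_left fun n (hn : j ≤ n) ↦ hij.trans hn
  rw [hmonoU.measure_iUnion]
  exact iSup_le fun m ↦ (measure_mono (Set.biInter_subset_of_mem (show m ≥ m from le_rfl))).trans
    (hE m)

/-- Paths of a Lévy process with a logarithmic moment grow slower than `e^{s/2}`. -/
theorem ae_exists_abs_le_exp_half (hY : IsTwoSidedLevyProcess P Y)
    (hlog : Integrable (fun ω ↦ Real.posLog |Y 1 ω|) P) :
    ∀ᵐ ω ∂P, ∃ (C : ℝ) (K : ℕ), ∀ s : ℝ, K ≤ s → |Y s ω| ≤ C * Real.exp (s / 2) := by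
  obtain ⟨β, hβ0, hβ⟩ := hY.exists_measure_lt_abs_sub_le_half
  let F (k : ℕ) : Set Ω := {ω | ∃ s ∈ Set.Icc ((k : ℤ) : ℝ) ((k : ℤ) + 1),
    Real.exp (k / 2) + β < |Y s ω - Y (k : ℤ) ω|}
  -- Borel–Cantelli: `P (F k) ≤ 2 P (2 log⁺ |Y 1| > k)`, which is summable by the logarithmic
  -- moment.
  have hsum : ∑' k, P (F k) ≠ ∞ := by
    have h1 : ∑' k : ℕ, P {ω | 2 * Real.posLog |Y 1 ω| ∈ Set.Ioi (k : ℝ)} < ∞ :=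
      @tsum_prob_mem_Ioi_lt_top Ω ⟨P⟩ ‹_› _ (hlog.const_mul 2)
        fun ω ↦ mul_nonneg zero_le_two Real.posLog_nonneg
    have h2 : ∑' k : ℕ, 2 * P {ω | 2 * Real.posLog |Y 1 ω| ∈ Set.Ioi (k : ℝ)} < ∞ := by
      rw [ENNReal.tsum_mul_left]
      exact ENNReal.mul_lt_top (by simp) h1
    refine (lt_of_le_of_lt (ENNReal.tsum_le_tsum fun k ↦ ?_) h2).ne
    refine (hY.measure_exists_lt_abs_sub_le hβ k (Real.exp (k / 2))).trans ?_
    refine mul_le_mul' le_rfl (measure_mono fun ω hω ↦ ?_)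
    have hlt : Real.exp (k / 2) < |Y 1 ω| := hω
    have := (Real.lt_log_iff_exp_lt ((Real.exp_pos _).trans hlt)).2 hlt
    have h3 : Real.log |Y 1 ω| ≤ Real.posLog |Y 1 ω| := le_max_right _ _
    change (k : ℝ) < 2 * Real.posLog |Y 1 ω|
    linarith
  filter_upwards [ae_eventually_notMem hsum] with ω hω
  obtain ⟨K, hK⟩ := eventually_atTop.1 hω
  have hstep (k : ℕ) (hk : K ≤ k) (s : ℝ) (hs : s ∈ Set.Icc (k : ℝ) (k + 1)) :
      |Y s ω - Y k ω| ≤ Real.exp (k / 2) + β := by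
    by_contra! hcon
    exact hK k hk ⟨s, by exact_mod_cast hs, by exact_mod_cast hcon⟩
  -- Since `e^{1/2} ≥ 3/2`, the induction needs `e^{k/2} + β ≤ (C / 2) e^{k/2}`; `C ≥ 2 (1 + β)`
  -- ensures this.
  set C : ℝ := max |Y K ω| (2 * (1 + β))
  have hCβ : 2 * (1 + β) ≤ C := le_max_right _ _
  have hexp1 (k : ℕ) : 1 ≤ Real.exp ((k : ℝ) / 2) := Real.one_le_exp (by positivity)
  have hint (k : ℕ) (hk : K ≤ k) : |Y k ω| ≤ C * Real.exp (k / 2) := by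
    induction k, hk using Nat.le_induction with
    | base =>
      have : |Y K ω| ≤ C := le_max_left _ _
      nlinarith [hexp1 K]
    | succ k hk ih =>
      have h1 := hstep k hk (k + 1) ⟨by linarith, le_rfl⟩
      have h2 := abs_add_le (Y (k + 1) ω - Y k ω) (Y k ω)
      rw [sub_add_cancel] at h2
      have h3 : Real.exp (((k : ℝ) + 1) / 2) = Real.exp (k / 2) * Real.exp (1 / 2) := by
        rw [← Real.exp_add]
        ring_nf
      have h4 : (1 : ℝ) / 2 + 1 ≤ Real.exp (1 / 2) := Real.add_one_le_exp _
      push_cast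
      rw [h3]
      have h5 := hexp1 k
      have h6 : C * (Real.exp (k / 2) * (1 / 2 + 1)) ≤
          C * (Real.exp (k / 2) * Real.exp (1 / 2)) := by
        gcongr
      nlinarith
  refine ⟨2 * C, K, fun s hs ↦ ?_⟩
  have hs0 : 0 ≤ s := le_trans (by positivity) hs
  have hk : K ≤ ⌊s⌋₊ := Nat.le_floor hs
  have h1 := hstep _ hk s ⟨Nat.floor_le hs0, (Nat.lt_floor_add_one s).le⟩
  have h2 := abs_add_le (Y s ω - Y ⌊s⌋₊ ω) (Y ⌊s⌋₊ ω)
  rw [sub_add_cancel] at h2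
  have h3 := hint _ hk
  have h4 := hexp1 ⌊s⌋₊
  have h5 : Real.exp ((⌊s⌋₊ : ℝ) / 2) ≤ Real.exp (s / 2) := by
    gcongr
    exact Nat.floor_le hs0
  nlinarith

end IsTwoSidedLevyProcess

/-- Against growth `e^{s/2}` the boundary term is `O(e^{-b/2})` and the integrand `O(e^{-s/2})`. -/
lemma exists_tendsto_pathIntegral {y : ℝ → ℝ}
    (hy : ∀ s : ℝ, ContinuousWithinAt y (Set.Ici s) s ∧ ∃ l : ℝ, Tendsto y (𝓝[<] s) (𝓝 l))
    {C : ℝ} {K : ℕ} (hC : ∀ s : ℝ, K ≤ s → |y s| ≤ C * Real.exp (s / 2)) (a : ℝ) :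
    ∃ l, Tendsto (fun b ↦ pathIntegral (fun s ↦ Real.exp (-s)) y a b) atTop (𝓝 l) := by
  have hym : Measurable y := measurable_of_rightContinuous fun s ↦ (hy s).1
  have hexp (s : ℝ) : Real.exp (s / 2) * Real.exp (-s) = Real.exp (-(1 / 2) * s) := by
    rw [← Real.exp_add]
    ring_nf
  have hbd : Tendsto (fun b ↦ Real.exp (-b) * y b) atTop (𝓝 0) := by
    have h0 : Tendsto (fun b : ℝ ↦ C * Real.exp (-(1 / 2) * b)) atTop (𝓝 0) := by
      have h1 : Tendsto (fun b : ℝ ↦ -(1 / 2) * b) atTop atBot :=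
        tendsto_id.const_mul_atTop_of_neg (by norm_num)
      simpa using (Real.tendsto_exp_atBot.comp h1).const_mul C
    refine squeeze_zero_norm' ?_ h0
    filter_upwards [eventually_ge_atTop (K : ℝ)] with b hb
    rw [norm_mul, Real.norm_eq_abs, Real.norm_eq_abs, abs_of_pos (Real.exp_pos _), ← hexp]
    nlinarith [hC b hb, Real.exp_pos (-b)]
  have hint : IntegrableOn (fun s ↦ y s * -Real.exp (-s)) (Set.Ioi a) := by
    have hm : Measurable fun s ↦ y s * -Real.exp (-s) := by fun_prop
    have hsub : Set.Ioi a ⊆ Set.Icc a (max a K) ∪ Set.Ioi (max a K) := fun s hs ↦ by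
      rcases le_or_gt s (max a K) with h | h
      · exact Or.inl ⟨le_of_lt hs, h⟩
      · exact Or.inr h
    refine IntegrableOn.mono_set (IntegrableOn.union ?_ ?_) hsub
    · obtain ⟨M, hM⟩ := exists_forall_abs_le_of_cadlag hy a (max a K)
      refine Integrable.of_bound hm.aestronglyMeasurable (M * Real.exp (-a)) ?_
      refine ae_restrict_of_forall_mem measurableSet_Icc fun s hs ↦ ?_
      rw [norm_mul, norm_neg, Real.norm_eq_abs, Real.norm_eq_abs, abs_of_pos (Real.exp_pos _)]
      have h1 := hM s hs
      have h2 : Real.exp (-s) ≤ Real.exp (-a) := Real.exp_le_exp.2 (by linarith [hs.1])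
      have h3 : 0 ≤ M := (abs_nonneg _).trans h1
      gcongr
    · refine Integrable.mono' ((integrableOn_exp_mul_Ioi (a := -(1 / 2)) (by norm_num)
        (max a K)).const_mul C) hm.aestronglyMeasurable ?_
      refine ae_restrict_of_forall_mem measurableSet_Ioi fun s hs ↦ ?_
      rw [norm_mul, norm_neg, Real.norm_eq_abs, Real.norm_eq_abs, abs_of_pos (Real.exp_pos _),
        ← hexp]
      have := hC s ((le_max_right _ _).trans (le_of_lt hs))
      nlinarith [Real.exp_pos (-s)]
  simp_rw [pathIntegral_exp_neg]
  exact ⟨_, (hbd.sub_const _).sub (intervalIntegral_tendsto_integral_Ioi a hint tendsto_id)⟩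

end Growth

/-! ### From characteristic functions to integrability of `1 ∧ y²`. -/

section CosineAverage

lemma exists_mul_min_le_integral_one_sub_cos {δ : ℝ} (hδ : 0 < δ) :
    ∃ c > 0, ∀ y : ℝ, c * min 1 (y ^ 2) ≤ ∫ u in (0 : ℝ)..δ, (1 - Real.cos (y * u)) := by
  have hπ := Real.pi_pos
  -- One constant per regime. If `|y| δ ≤ 2 < π`, then `1 - cos (y u) ≥ 2 (y u)² / π²` is
  -- integrated; otherwise the sine term is at most `1 / |y| ≤ δ / 2` and half of `δ` survives.
  refine ⟨min (δ / 2) (2 / Real.pi ^ 2 * (δ ^ 3 / 3)), by positivity, fun y ↦ ?_⟩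
  rcases le_or_gt (|y| * δ) 2 with h | h
  · calc min (δ / 2) (2 / Real.pi ^ 2 * (δ ^ 3 / 3)) * min 1 (y ^ 2)
        ≤ 2 / Real.pi ^ 2 * (δ ^ 3 / 3) * y ^ 2 := by
          gcongr
          · exact min_le_right _ _
          · exact min_le_right _ _
      _ = ∫ u in (0 : ℝ)..δ, 2 / Real.pi ^ 2 * y ^ 2 * u ^ 2 := by
          rw [intervalIntegral.integral_const_mul, integral_pow]
          ring
      _ ≤ ∫ u in (0 : ℝ)..δ, (1 - Real.cos (y * u)) := by
          refine intervalIntegral.integral_mono_on hδ.le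
            (Continuous.intervalIntegrable (by fun_prop) _ _)
            (Continuous.intervalIntegrable (by fun_prop) _ _) fun u hu ↦ ?_
          have hyu : |y * u| ≤ Real.pi := by
            rw [abs_mul, abs_of_nonneg hu.1]
            have : |y| * u ≤ |y| * δ := by gcongr; exact hu.2
            linarith [Real.pi_gt_three]
          have := Real.cos_le_one_sub_mul_cos_sq hyu
          rw [mul_pow] at this
          linarith
  · have hy : y ≠ 0 := fun h0 ↦ by
      rw [h0, abs_zero, zero_mul] at h
      linarith
    have hint : ∫ u in (0 : ℝ)..δ, (1 - Real.cos (y * u)) = δ - y⁻¹ * Real.sin (y * δ) := by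
      rw [intervalIntegral.integral_sub intervalIntegrable_const
        (Continuous.intervalIntegrable (by fun_prop) _ _),
        intervalIntegral.integral_comp_mul_left Real.cos hy]
      simp
    have hle : y⁻¹ * Real.sin (y * δ) ≤ δ / 2 := by
      refine (le_abs_self _).trans ?_
      rw [abs_mul, abs_inv]
      have h1 := Real.abs_sin_le_one (y * δ)
      have h2 : |y|⁻¹ * |Real.sin (y * δ)| ≤ |y|⁻¹ * 1 := by gcongr
      have h3 : |y|⁻¹ ≤ δ / 2 := by
        rw [inv_le_comm₀ (abs_pos.2 hy) (by positivity), inv_div, div_le_iff₀ hδ]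
        exact h.le
      linarith
    rw [hint]
    have h1 : min (δ / 2) (2 / Real.pi ^ 2 * (δ ^ 3 / 3)) * min 1 (y ^ 2) ≤ δ / 2 * 1 := by
      gcongr
      · exact min_le_left _ _
      · exact min_le_left _ _
    linarith

/-- A measure whose cosine transforms are bounded near the origin integrates `1 ∧ y²`. -/
lemma lintegral_min_one_sq_lt_top_of_one_sub_cos {α : Type*} [MeasurableSpace α] {m : Measure α}
    [SFinite m] {f : α → ℝ} (hf : Measurable f) {δ : ℝ} (hδ : 0 < δ) {c : ℝ≥0∞} (hc : c < ∞)
    (h : ∀ u ∈ Set.Ioc 0 δ, ∫⁻ a, ENNReal.ofReal (1 - Real.cos (f a * u)) ∂m ≤ c) :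
    ∫⁻ a, ENNReal.ofReal (min 1 (f a ^ 2)) ∂m < ∞ := by
  obtain ⟨ε, hε, hle⟩ := exists_mul_min_le_integral_one_sub_cos hδ
  have h1 : ∫⁻ a, ENNReal.ofReal ε * ENNReal.ofReal (min 1 (f a ^ 2)) ∂m < ∞ := by
    calc ∫⁻ a, ENNReal.ofReal ε * ENNReal.ofReal (min 1 (f a ^ 2)) ∂m
        ≤ ∫⁻ a, (∫⁻ u in Set.Ioc 0 δ, ENNReal.ofReal (1 - Real.cos (f a * u))) ∂m := by
          refine lintegral_mono fun a ↦ ?_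
          rw [← ENNReal.ofReal_mul hε.le, ← ofReal_integral_eq_lintegral_ofReal]
          · rw [← intervalIntegral.integral_of_le hδ.le]
            exact ENNReal.ofReal_le_ofReal (hle _)
          · exact (Continuous.integrableOn_Icc (by fun_prop)).mono_set Set.Ioc_subset_Icc_self
          · exact Eventually.of_forall fun u ↦ sub_nonneg.2 (Real.cos_le_one _)
      _ = ∫⁻ u in Set.Ioc 0 δ, ∫⁻ a, ENNReal.ofReal (1 - Real.cos (f a * u)) ∂m := by
          refine lintegral_lintegral_swap (Measurable.aemeasurable ?_)
          fun_prop
      _ ≤ ∫⁻ u in Set.Ioc 0 δ, c := setLIntegral_mono measurable_const h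
      _ < ∞ := by
          rw [setLIntegral_const]
          exact ENNReal.mul_lt_top hc (by simp)
  rw [lintegral_const_mul' _ _ ENNReal.ofReal_ne_top] at h1
  refine lt_top_iff_ne_top.2 fun htop ↦ ?_
  rw [htop, ENNReal.mul_top (by simpa using hε)] at h1
  exact lt_irrefl _ h1

end CosineAverage

/-- The drift is imaginary and the Gaussian term has a favourable sign. A lower bound on the modulus
of a characteristic function thus bounds the jump measure. -/
lemma lintegral_one_sub_cos_le_neg_re_levyExponent {E : Type*} [NormedAddCommGroup E]
    [InnerProductSpace ℝ E] [MeasurableSpace E] [BorelSpace E] [SecondCountableTopology E]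
    {ρ : Measure E} (h : ∫⁻ x, ENNReal.ofReal (min 1 (‖x‖ ^ 2)) ∂ρ < ∞) (b : E)
    {S : E →L[ℝ] E} (hS : S.IsPositive) (v : E) :
    ∫⁻ x, ENNReal.ofReal (1 - Real.cos (inner ℝ x v)) ∂ρ
      ≤ ENNReal.ofReal (-(levyExponent b S ρ v).re) := by
  have hre (x : E) : (levyKernel x v).re = -(1 - Real.cos (inner ℝ x v)) := by
    unfold levyKernel
    split_ifs <;> simp [Complex.exp_ofReal_mul_I_re]
  have hK := integrable_levyKernel h v
  have hint : Integrable (fun x ↦ 1 - Real.cos (inner ℝ x v)) ρ :=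
    hK.re.neg.congr (Eventually.of_forall fun x ↦ by
      change -(levyKernel x v).re = _
      rw [hre, neg_neg])
  have hIre : (∫ x, levyKernel x v ∂ρ).re = -∫ x, (1 - Real.cos (inner ℝ x v)) ∂ρ := by
    have := integral_re hK
    change ∫ x, (levyKernel x v).re ∂ρ = (∫ x, levyKernel x v ∂ρ).re at this
    simp_rw [← this, hre, integral_neg]
  rw [← ofReal_integral_eq_lintegral_ofReal hint
    (Eventually.of_forall fun x ↦ sub_nonneg.2 (Real.cos_le_one _))]
  refine ENNReal.ofReal_le_ofReal ?_
  unfold levyExponent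
  have h0 := hS.inner_nonneg_left v
  have hS2 : (((inner ℝ (S v) v : ℝ) : ℂ) / 2).re = inner ℝ (S v) v / 2 := by
    rw [Complex.div_ofNat_re, Complex.ofReal_re]
  rw [Complex.add_re, Complex.sub_re, Complex.re_ofReal_mul, Complex.I_re, hIre, hS2]
  linarith

section

variable {Ω : Type*} [MeasurableSpace Ω] {P : Measure Ω} [IsProbabilityMeasure P]
  {Y : ℝ → Ω → ℝ}

lemma integrable_comp_mul_indicator_exp_neg {ψ : ℝ → ℂ} (hψ : Continuous ψ) (hψ0 : ψ 0 = 0)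
    (u a b : ℝ) :
    Integrable fun s ↦ ψ (u * (Set.Ico a b).indicator (fun s ↦ Real.exp (-s)) s) := by
  have heq : (fun s ↦ ψ (u * (Set.Ico a b).indicator (fun s ↦ Real.exp (-s)) s))
      = (Set.Ico a b).indicator fun s ↦ ψ (u * Real.exp (-s)) := by
    ext1 s
    by_cases hs : s ∈ Set.Ico a b <;> simp [hs, hψ0]
  rw [heq, integrable_indicator_iff measurableSet_Ico]
  exact (Continuous.integrableOn_Icc (by fun_prop)).mono_set Set.Ico_subset_Icc_self

/-- If `∫_a^∞ e^{-s} dY_s` converges, then its prospective Lévy measure integrates `1 ∧ y²`. -/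
theorem IsTwoSidedLevyProcess.lintegral_min_one_sq_lt_top (hY : IsTwoSidedLevyProcess P Y)
    {ρ : Measure ℝ} [SFinite ρ] (hρ : ∫⁻ x, ENNReal.ofReal (min 1 (‖x‖ ^ 2)) ∂ρ < ∞) {β : ℝ}
    {S : ℝ →L[ℝ] ℝ} (hS : S.IsPositive)
    (h1 : ∀ u, charFun (P.map (Y 1)) u = Complex.exp (levyExponent β S ρ u)) {a : ℝ} {Z : Ω → ℝ}
    (hZ : ∀ᵐ ω ∂P, Tendsto
      (fun b : ℝ ↦ pathIntegral (fun s ↦ Real.exp (-s)) (fun s ↦ Y s ω) a b) atTop (𝓝 (Z ω))) :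
    ∫⁻ p, ENNReal.ofReal (min 1 ((p.2 * Real.exp (-p.1)) ^ 2))
      ∂((volume.restrict (Set.Ici a)).prod ρ) < ∞ := by
  have hψ := continuous_levyExponent hρ β S
  have hψ0 := levyExponent_zero β S ρ
  set ψ := levyExponent β S ρ
  let V (m : ℕ) (ω : Ω) : ℝ :=
    pathIntegral (fun s ↦ Real.exp (-s)) (fun s ↦ Y s ω) a (a + m)
  have ham (m : ℕ) : a ≤ a + m := by linarith [m.cast_nonneg (α := ℝ)]
  have hVm (m : ℕ) : AEMeasurable (V m) P := hY.aemeasurable_pathIntegral (ham m)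
  have hVlim : ∀ᵐ ω ∂P, Tendsto (fun m ↦ V m ω) atTop (𝓝 (Z ω)) := by
    filter_upwards [hZ] with ω hω
    exact hω.comp (tendsto_atTop_add_const_left _ a tendsto_natCast_atTop_atTop)
  have hZm : AEMeasurable Z P := aemeasurable_of_tendsto_metrizable_ae atTop hVm hVlim
  have := Measure.isProbabilityMeasure_map hZm
  have hφ (m : ℕ) (u : ℝ) : charFun (P.map (V m)) u
      = Complex.exp (∫ s, ψ (u * (Set.Ico a (a + m)).indicator (fun s ↦ Real.exp (-s)) s)) := by
    have h2 := hY.charFun_sum_pathIntegral hψ hψ0 h1 {()} (fun _ ↦ a) (fun _ ↦ u)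
      (fun _ _ ↦ ham m)
    simp only [Finset.sum_singleton] at h2
    rw [← h2]
    have h3 := charFun_map_mul_comp (hVm m) u 1
    rw [mul_one] at h3
    exact h3.symm
  obtain ⟨δ, hδ, hball⟩ : ∃ δ > 0, ∀ u ∈ Set.Ioc 0 δ, 1 / 2 < ‖charFun (P.map Z) u‖ := by
    have hcont : Continuous fun u ↦ ‖charFun (P.map Z) u‖ := continuous_charFun.norm
    have h0 : 1 / 2 < ‖charFun (P.map Z) 0‖ := by
      rw [charFun_zero, probReal_univ]
      norm_num
    obtain ⟨δ, hδ, hsub⟩ := Metric.mem_nhds_iff.1 (hcont.continuousAt.eventually_const_lt h0)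
    refine ⟨δ / 2, by positivity, fun u hu ↦ hsub ?_⟩
    rw [Metric.mem_ball, dist_zero_right, Real.norm_of_nonneg hu.1.le]
    linarith [hu.2]
  refine lintegral_min_one_sq_lt_top_of_one_sub_cos (f := fun p : ℝ × ℝ ↦ p.2 * Real.exp (-p.1))
    (by fun_prop) hδ (ENNReal.ofReal_lt_top (r := Real.log 2)) fun u hu ↦ ?_
  rw [lintegral_prod _ (by fun_prop)]
  have hIci : Set.Ici a = ⋃ m : ℕ, Set.Ico a (a + m) := by
    ext s
    simp only [Set.mem_Ici, Set.mem_iUnion, Set.mem_Ico]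
    refine ⟨fun hs ↦ ?_, fun ⟨_, hs, _⟩ ↦ hs⟩
    obtain ⟨m, hm⟩ := exists_nat_gt (s - a)
    exact ⟨m, hs, by linarith⟩
  have hmono : Monotone fun m : ℕ ↦ Set.Ico a (a + m) := fun i j hij ↦
    Set.Ico_subset_Ico_right (by gcongr)
  simp only
  rw [hIci, setLIntegral_iUnion_of_directed _ hmono.directed_le]
  -- The characteristic functions converge to one exceeding `1/2` in modulus, so eventually minus
  -- the real part of the exponent is at most `log 2`, whatever `u ∈ (0, δ]`.
  have hbound : ∀ᶠ m : ℕ in atTop, ∫⁻ s in Set.Ico a (a + m),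
      ∫⁻ x, ENNReal.ofReal (1 - Real.cos (x * Real.exp (-s) * u)) ∂ρ
        ≤ ENNReal.ofReal (Real.log 2) := by
    have hlim := (tendsto_charFun_map_of_ae_tendsto hVm hVlim u).norm
    filter_upwards [hlim.eventually_const_lt (hball u hu)] with m hm
    rw [hφ, Complex.norm_exp] at hm
    have hI := integrable_comp_mul_indicator_exp_neg hψ hψ0 u a (a + m)
    have hlog : -(∫ s, ψ (u * (Set.Ico a (a + m)).indicator (fun s ↦ Real.exp (-s)) s)).re
        ≤ Real.log 2 := by
      have := (Real.log_lt_iff_lt_exp (by norm_num)).2 hm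
      rw [one_div, Real.log_inv] at this
      linarith
    have hre : ∫ s, -(ψ (u * (Set.Ico a (a + m)).indicator (fun s ↦ Real.exp (-s)) s)).re
        = -(∫ s, ψ (u * (Set.Ico a (a + m)).indicator (fun s ↦ Real.exp (-s)) s)).re := by
      rw [integral_neg]
      exact congrArg Neg.neg (integral_re hI)
    have hpt (v : ℝ) := lintegral_one_sub_cos_le_neg_re_levyExponent hρ β hS v
    have hnonneg (v : ℝ) : 0 ≤ -(ψ v).re := by
      have hn : ‖Complex.exp (ψ v)‖ ≤ 1 := by
        have := Measure.isProbabilityMeasure_map (μ := P) (hY.measurable 1).aemeasurable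
        rw [← h1]
        exact norm_charFun_le_one v
      rw [Complex.norm_exp, Real.exp_le_one_iff] at hn
      linarith
    refine le_trans ?_ (ENNReal.ofReal_le_ofReal hlog)
    have hIre : Integrable fun s ↦
        -(ψ (u * (Set.Ico a (a + m)).indicator (fun s ↦ Real.exp (-s)) s)).re := hI.re.neg
    rw [← hre, ofReal_integral_eq_lintegral_ofReal hIre
      (Eventually.of_forall fun s ↦ hnonneg _), ← lintegral_indicator measurableSet_Ico]
    refine lintegral_mono fun s ↦ ?_
    by_cases hs : s ∈ Set.Ico a (a + m)
    · rw [Set.indicator_of_mem hs]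
      refine le_trans (le_of_eq ?_) (hpt _)
      rw [Set.indicator_of_mem hs]
      refine lintegral_congr fun x ↦ ?_
      congr 3
      simp only [RCLike.inner_apply, conj_trivial]
      ring
    · rw [Set.indicator_of_notMem hs]
      exact zero_le
  obtain ⟨M, hM⟩ := eventually_atTop.1 hbound
  -- The threshold depends on `u`, but the integrals increase with `m`, so the bound holds for every
  -- `m`.
  refine iSup_le fun m ↦ le_trans ?_ (hM (max m M) (le_max_right _ _))
  exact lintegral_mono_set (hmono (le_max_left m M))

end

/-! ### Integrating an exponent along a kernel. -/

section IntegratedExponent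

variable {E : Type*} [NormedAddCommGroup E] [InnerProductSpace ℝ E]

/-- The difference of the truncated jump `x • y` in `E` and of the jump of size `x`, truncated as
a real number, in the direction `y`. -/
def truncationDifference (x : ℝ) (y : E) : E :=
  (if ‖x • y‖ ≤ 1 then x • y else 0) - if ‖x‖ ≤ 1 then x • y else 0

/-- The exponentials coincide and only the compensators differ, by a term linear in `u` that can
join the drift. -/
lemma levyKernel_inner_eq (x : ℝ) (y u : E) :
    levyKernel x (inner ℝ y u) = levyKernel (x • y) u
      + (inner ℝ (truncationDifference x y) u : ℝ) * Complex.I := by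
  unfold levyKernel truncationDifference
  have h : inner ℝ x (inner ℝ y u) = inner ℝ (x • y) u := by
    rw [real_inner_smul_left]
    simp [mul_comm]
  rw [h, inner_sub_left]
  split_ifs <;> simp [sub_eq_add_neg]

/-- The truncations disagree in two ways. If `|x| > 1` and `‖x • f s‖ ≤ 1`, the lower bound on `f`
forces `s ≥ log |x|`. If `|x| ≤ 1` and `‖x • f s‖ > 1`, the norm is at most its square. -/
lemma norm_truncationDifference_le {f : ℝ → E} {a C : ℝ} (hC0 : 0 ≤ C)
    (hC : ∀ s, ‖f s‖ ≤ (Set.Ici a).indicator (fun s ↦ C * Real.exp (-s)) s)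
    (hlow : ∀ s, f s ≠ 0 → Real.exp (-s) ≤ ‖f s‖) (s x : ℝ) :
    ‖truncationDifference x (f s)‖
      ≤ {p : ℝ × ℝ | 1 < |p.2| ∧ Real.log |p.2| ≤ p.1}.indicator
          (fun p ↦ C * |p.2| * Real.exp (-p.1)) (s, x)
        + (Set.Ici a).indicator (fun s ↦ C ^ 2 * Real.exp (-2 * s)) s * min 1 (‖x‖ ^ 2) := by
  have hn1 : 0 ≤ {p : ℝ × ℝ | 1 < |p.2| ∧ Real.log |p.2| ≤ p.1}.indicator
      (fun p ↦ C * |p.2| * Real.exp (-p.1)) (s, x) :=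
    Set.indicator_nonneg (fun p _ ↦ by positivity) _
  have hn2 : 0 ≤ (Set.Ici a).indicator (fun s ↦ C ^ 2 * Real.exp (-2 * s)) s
      * min 1 (‖x‖ ^ 2) :=
    mul_nonneg (Set.indicator_nonneg (fun p _ ↦ by positivity) _) (by positivity)
  by_cases hf0 : f s = 0
  · simp only [truncationDifference, hf0, smul_zero, ite_self, sub_zero, norm_zero]
    exact add_nonneg hn1 hn2
  have hs : s ∈ Set.Ici a := by
    by_contra hs
    have := hC s
    rw [Set.indicator_of_notMem hs] at this
    exact hf0 (norm_le_zero_iff.1 this)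
  have hCs := hC s
  rw [Set.indicator_of_mem hs] at hCs
  have hls := hlow s hf0
  unfold truncationDifference
  split_ifs with h1 h2 h2
  · rw [sub_self, norm_zero]
    exact add_nonneg hn1 hn2
  · rw [sub_zero]
    refine le_add_of_le_of_nonneg ?_ hn2
    rw [norm_smul, Real.norm_eq_abs] at h1 ⊢
    rw [Real.norm_eq_abs, not_le] at h2
    have hmem : (s, x) ∈ {p : ℝ × ℝ | 1 < |p.2| ∧ Real.log |p.2| ≤ p.1} := by
      refine ⟨h2, ?_⟩
      rw [Real.log_le_iff_le_exp (by linarith)]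
      have h3 : |x| * Real.exp (-s) ≤ 1 := le_trans (by gcongr) h1
      rw [Real.exp_neg, ← div_eq_mul_inv, div_le_one (Real.exp_pos s)] at h3
      exact h3
    rw [Set.indicator_of_mem hmem]
    nlinarith [abs_nonneg x]
  · rw [zero_sub, norm_neg]
    refine le_add_of_nonneg_of_le hn1 ?_
    rw [Set.indicator_of_mem hs, min_eq_right (by nlinarith [norm_nonneg x])]
    rw [norm_smul, not_le] at h1
    rw [norm_smul]
    have h3 : ‖x‖ * ‖f s‖ ≤ ‖x‖ * (C * Real.exp (-s)) := by gcongr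
    have h4 : Real.exp (-2 * s) = Real.exp (-s) ^ 2 := by
      rw [← Real.exp_nat_mul]
      ring_nf
    rw [h4]
    nlinarith
  · rw [sub_self, norm_zero]
    exact add_nonneg hn1 hn2

lemma integrable_indicator_Ici_exp_neg_mul {c : ℝ} (hc : 0 < c) (a C : ℝ) :
    Integrable ((Set.Ici a).indicator fun s ↦ C * Real.exp (-c * s)) := by
  rw [integrable_indicator_iff measurableSet_Ici, integrableOn_Ici_iff_integrableOn_Ioi]
  exact (integrableOn_exp_mul_Ioi (by linarith) a).const_mul C

/-- The integral of `|x| e^{-s}` over `s ≥ log |x|` is exactly `1`, which leaves `C` times the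
`ρ`-mass of `{|x| > 1}`. -/
lemma integrable_indicator_log_le {ρ : Measure ℝ} [SFinite ρ]
    (hρ : ∫⁻ x, ENNReal.ofReal (min 1 (‖x‖ ^ 2)) ∂ρ < ∞) {C : ℝ} (hC : 0 ≤ C) :
    Integrable ({p : ℝ × ℝ | 1 < |p.2| ∧ Real.log |p.2| ≤ p.1}.indicator
      fun p ↦ C * |p.2| * Real.exp (-p.1)) (volume.prod ρ) := by
  have hmS : MeasurableSet {p : ℝ × ℝ | 1 < |p.2| ∧ Real.log |p.2| ≤ p.1} := by
    have hm₁ : MeasurableSet {p : ℝ × ℝ | 1 < |p.2|} :=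
      measurableSet_lt (by fun_prop) (by fun_prop)
    have hm₂ : MeasurableSet {p : ℝ × ℝ | Real.log |p.2| ≤ p.1} :=
      measurableSet_le (by fun_prop) (by fun_prop)
    exact hm₁.inter hm₂
  have hm : Measurable ({p : ℝ × ℝ | 1 < |p.2| ∧ Real.log |p.2| ≤ p.1}.indicator
      fun p ↦ C * |p.2| * Real.exp (-p.1)) := Measurable.indicator (by fun_prop) hmS
  refine ⟨hm.aestronglyMeasurable, ?_⟩
  rw [hasFiniteIntegral_iff_ofReal (Eventually.of_forall fun p ↦
    Set.indicator_nonneg (fun p _ ↦ by positivity) p), lintegral_prod_symm' _ (by fun_prop)]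
  refine lt_of_le_of_lt (lintegral_mono fun x ↦ ?_)
    (b := ∫⁻ x, ENNReal.ofReal C * ENNReal.ofReal (min 1 (‖x‖ ^ 2)) ∂ρ) ?_
  · rcases le_or_gt |x| 1 with hx | hx
    · refine le_trans (le_of_eq ?_) zero_le
      rw [lintegral_eq_zero_iff' (by fun_prop)]
      refine Eventually.of_forall fun s ↦ ?_
      simp only
      rw [Set.indicator_of_notMem
        (show (s, x) ∉ {p : ℝ × ℝ | 1 < |p.2| ∧ Real.log |p.2| ≤ p.1} from
          fun h ↦ absurd h.1 (not_lt.2 hx))]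
      simp
    · have heq (s : ℝ) : ENNReal.ofReal
          ({p : ℝ × ℝ | 1 < |p.2| ∧ Real.log |p.2| ≤ p.1}.indicator
            (fun p ↦ C * |p.2| * Real.exp (-p.1)) (s, x))
          = (Set.Ici (Real.log |x|)).indicator
            (fun s ↦ ENNReal.ofReal (C * |x| * Real.exp (-s))) s := by
        by_cases hs : Real.log |x| ≤ s
        · rw [Set.indicator_of_mem (show (s, x) ∈ {p : ℝ × ℝ | 1 < |p.2| ∧ Real.log |p.2| ≤ p.1}
            from ⟨hx, hs⟩), Set.indicator_of_mem (show s ∈ Set.Ici _ from hs)]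
        · rw [Set.indicator_of_notMem
            (show (s, x) ∉ {p : ℝ × ℝ | 1 < |p.2| ∧ Real.log |p.2| ≤ p.1} from fun h ↦ hs h.2),
            Set.indicator_of_notMem (show s ∉ Set.Ici _ from hs), ENNReal.ofReal_zero]
      simp_rw [heq]
      rw [lintegral_indicator measurableSet_Ici, setLIntegral_congr Ioi_ae_eq_Ici.symm,
        ← ofReal_integral_eq_lintegral_ofReal
          (by simpa using (integrableOn_exp_mul_Ioi (a := -1) (by norm_num)
            (Real.log |x|)).const_mul (C * |x|))
          (Eventually.of_forall fun s ↦ by positivity),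
        integral_const_mul, integral_exp_neg_Ioi, Real.exp_neg, Real.exp_log (by linarith),
        mul_assoc, mul_inv_cancel₀ (by linarith), mul_one, min_eq_left, ENNReal.ofReal_one, mul_one]
      rw [Real.norm_eq_abs]
      nlinarith
  · rw [lintegral_const_mul' _ _ ENNReal.ofReal_ne_top]
    exact ENNReal.mul_lt_top ENNReal.ofReal_lt_top hρ

variable [FiniteDimensional ℝ E] [MeasurableSpace E] [BorelSpace E]

lemma measurable_truncationDifference {f : ℝ → E} (hf : Measurable f) :
    Measurable fun p : ℝ × ℝ ↦ truncationDifference p.2 (f p.1) := by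
  unfold truncationDifference
  have h : Measurable fun p : ℝ × ℝ ↦ p.2 • f p.1 := by fun_prop
  refine (Measurable.ite ?_ h measurable_const).sub (Measurable.ite ?_ h measurable_const)
  · exact measurableSet_le h.norm measurable_const
  · exact measurableSet_le (by fun_prop) measurable_const

lemma integrable_truncationDifference {ρ : Measure ℝ} [SFinite ρ]
    (hρ : ∫⁻ x, ENNReal.ofReal (min 1 (‖x‖ ^ 2)) ∂ρ < ∞) {f : ℝ → E} (hf : Measurable f)
    {a C : ℝ} (hC0 : 0 ≤ C)
    (hC : ∀ s, ‖f s‖ ≤ (Set.Ici a).indicator (fun s ↦ C * Real.exp (-s)) s)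
    (hlow : ∀ s, f s ≠ 0 → Real.exp (-s) ≤ ‖f s‖) :
    Integrable (fun p : ℝ × ℝ ↦ truncationDifference p.2 (f p.1)) (volume.prod ρ) :=
  ((integrable_indicator_log_le hρ hC0).add
    ((integrable_indicator_Ici_exp_neg_mul two_pos a (C ^ 2)).mul_prod
      (integrable_min_one_sq hρ))).mono'
    (measurable_truncationDifference hf).aestronglyMeasurable
    (Eventually.of_forall fun p ↦ norm_truncationDifference_le hC0 hC hlow p.1 p.2)

/-- Integrating a real Lévy–Khintchine exponent along `f` gives the Lévy–Khintchine exponent with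
Lévy measure the image of `ds ⊗ ρ` under `(s, x) ↦ x • f s`. -/
theorem exists_integral_levyExponent_inner {ρ : Measure ℝ} [SFinite ρ]
    (hρ : ∫⁻ x, ENNReal.ofReal (min 1 (‖x‖ ^ 2)) ∂ρ < ∞) (β : ℝ) {S : ℝ →L[ℝ] ℝ}
    (hS : S.IsPositive) {f : ℝ → E} (hf : Measurable f) {a C : ℝ} (hC0 : 0 ≤ C)
    (hC : ∀ s, ‖f s‖ ≤ (Set.Ici a).indicator (fun s ↦ C * Real.exp (-s)) s)
    (hlow : ∀ s, f s ≠ 0 → Real.exp (-s) ≤ ‖f s‖)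
    (hJ : ∫⁻ p, ENNReal.ofReal (min 1 (‖p.2 • f p.1‖ ^ 2)) ∂(volume.prod ρ) < ∞) :
    ∃ (b : E) (T : E →L[ℝ] E), T.IsPositive ∧ ∀ u : E,
      Integrable (fun s ↦ levyExponent β S ρ (inner ℝ (f s) u)) ∧
      ∫ s, levyExponent β S ρ (inner ℝ (f s) u) = levyExponent b T
        (((volume.prod ρ).map fun p : ℝ × ℝ ↦ p.2 • f p.1).restrict {0}ᶜ) u := by
  have hd := integrable_truncationDifference hρ hf hC0 hC hlow
  have hfi : Integrable f := by
    refine Integrable.mono' (g := (Set.Ici a).indicator fun s ↦ C * Real.exp (-1 * s))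
      (integrable_indicator_Ici_exp_neg_mul one_pos a C) hf.aestronglyMeasurable
      (Eventually.of_forall fun s ↦ ?_)
    simpa using hC s
  have hσ : 0 ≤ S 1 := by simpa using hS.inner_nonneg_left 1
  have hmul (x y : ℝ) : inner ℝ x y = x * y := by
    simp only [RCLike.inner_apply, conj_trivial, mul_comm]
  have hS1 (v : ℝ) : inner ℝ (S v) v = S 1 * v ^ 2 := by
    have : S v = v * S 1 := by
      rw [← smul_eq_mul, ← map_smul, smul_eq_mul, mul_one]
    rw [this, hmul]
    ring
  have hRi : Integrable fun s ↦ InnerProductSpace.rankOne ℝ (f s) (f s) := by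
    refine Integrable.mono' (g := (Set.Ici a).indicator fun s ↦ C ^ 2 * Real.exp (-2 * s))
      (integrable_indicator_Ici_exp_neg_mul two_pos a (C ^ 2)) ?_
      (Eventually.of_forall fun s ↦ ?_)
    · have hc : Continuous fun y : E ↦ InnerProductSpace.rankOne ℝ y y :=
        (InnerProductSpace.rankOne ℝ (E := E) (F := E)).continuous₂.comp
          (continuous_id.prodMk continuous_id)
      exact (hc.measurable.comp hf).aestronglyMeasurable
    · rw [InnerProductSpace.norm_rankOne]
      have h := hC s
      by_cases hs : s ∈ Set.Ici a
      · rw [Set.indicator_of_mem hs] at h ⊢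
        have h4 : Real.exp (-2 * s) = Real.exp (-s) ^ 2 := by
          rw [← Real.exp_nat_mul]
          ring_nf
        rw [h4, ← mul_pow, sq]
        gcongr
      · rw [Set.indicator_of_notMem hs] at h ⊢
        nlinarith [norm_nonneg (f s)]
  have hRinner (x y : E) :
      inner ℝ ((∫ s, InnerProductSpace.rankOne ℝ (f s) (f s)) x) y
        = ∫ s, inner ℝ (f s) x * inner ℝ (f s) y := by
    rw [ContinuousLinearMap.integral_apply hRi, real_inner_comm,
      ← integral_inner (hRi.apply_continuousLinearMap x)]
    refine integral_congr_ae (Eventually.of_forall fun s ↦ ?_)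
    simp only [InnerProductSpace.rankOne_apply, real_inner_smul_right]
    rw [real_inner_comm (f s) y]
  have hvi (u : E) : Integrable fun s ↦ inner ℝ (f s) u := hfi.inner_const u
  have hv2i (u : E) : Integrable fun s ↦ inner ℝ (f s) u ^ 2 := by
    have := (hRi.apply_continuousLinearMap u).inner_const (𝕜 := ℝ) u
    refine this.congr (Eventually.of_forall fun s ↦ ?_)
    simp only [InnerProductSpace.rankOne_apply, real_inner_smul_left]
    ring
  -- The drift collects the change of truncation; the covariance is the integral of `f s ⊗ f s`
  -- scaled by the variance `S 1`.
  refine ⟨β • (∫ s, f s) + ∫ p, truncationDifference p.2 (f p.1) ∂(volume.prod ρ),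
    S 1 • ∫ s, InnerProductSpace.rankOne ℝ (f s) (f s), ?_, fun u ↦ ?_⟩
  · refine ContinuousLinearMap.IsPositive.smul_of_nonneg (𝕜 := ℝ) ?_ hσ
    rw [ContinuousLinearMap.isPositive_iff]
    refine ⟨fun x y ↦ ?_, fun x ↦ ?_⟩
    · have h1 := hRinner x y
      have h2 := hRinner y x
      simp only [ContinuousLinearMap.coe_coe]
      rw [h1, real_inner_comm, h2]
      simp_rw [mul_comm]
    · rw [hRinner]
      exact integral_nonneg fun s ↦ mul_self_nonneg _
  have hgm : Measurable fun p : ℝ × ℝ ↦ p.2 • f p.1 := by fun_prop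
  have hK1 : Integrable (fun p : ℝ × ℝ ↦ levyKernel (p.2 • f p.1) u) (volume.prod ρ) := by
    have hmin : Integrable (fun p : ℝ × ℝ ↦ min 1 (‖p.2 • f p.1‖ ^ 2)) (volume.prod ρ) := by
      refine ⟨Measurable.aestronglyMeasurable (by fun_prop), ?_⟩
      rw [hasFiniteIntegral_iff_ofReal (Eventually.of_forall fun p ↦ by positivity)]
      exact hJ
    exact (hmin.const_mul _).mono' (Measurable.aestronglyMeasurable (by fun_prop))
      (Eventually.of_forall fun p ↦ norm_levyKernel_le _ u)
  have hdu : Integrable (fun p : ℝ × ℝ ↦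
      ((inner ℝ (truncationDifference p.2 (f p.1)) u : ℝ) : ℂ) * Complex.I) (volume.prod ρ) :=
    (hd.inner_const u).ofReal.mul_const _
  have hK0eq (p : ℝ × ℝ) := levyKernel_inner_eq p.2 (f p.1) u
  have hK0 : Integrable (fun p : ℝ × ℝ ↦ levyKernel p.2 (inner ℝ (f p.1) u)) (volume.prod ρ) := by
    simp_rw [hK0eq]
    exact hK1.add hdu
  have hterm1 : Integrable fun s ↦ ((inner ℝ β (inner ℝ (f s) u) : ℝ) : ℂ) * Complex.I := by
    have h : Integrable fun s ↦ inner ℝ β (inner ℝ (f s) u) := by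
      simp_rw [hmul]
      exact (hvi u).const_mul β
    exact h.ofReal.mul_const _
  have hterm2 : Integrable fun s ↦
      ((inner ℝ (S (inner ℝ (f s) u)) (inner ℝ (f s) u) : ℝ) : ℂ) / 2 := by
    simp_rw [hS1]
    exact ((hv2i u).const_mul (S 1)).ofReal.div_const 2
  have hterm3 := hK0.integral_prod_left
  refine ⟨(hterm1.sub hterm2).add hterm3, ?_⟩
  simp only [levyExponent]
  rw [integral_add (by exact hterm1.sub hterm2) (by exact hterm3), integral_sub hterm1 hterm2,
    ← integral_prod (fun p : ℝ × ℝ ↦ levyKernel p.2 (inner ℝ (f p.1) u)) hK0]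
  have e3 : ∫ p, levyKernel p.2 (inner ℝ (f p.1) u) ∂(volume.prod ρ)
      = ∫ p, levyKernel (p.2 • f p.1) u ∂(volume.prod ρ)
        + (inner ℝ (∫ p, truncationDifference p.2 (f p.1) ∂(volume.prod ρ)) u : ℝ)
          * Complex.I := by
    simp_rw [hK0eq]
    rw [integral_add hK1 hdu, integral_mul_const, integral_complex_ofReal, real_inner_comm,
      ← integral_inner hd]
    simp_rw [real_inner_comm u]
  -- Removing the origin is harmless because the kernel vanishes at a zero jump.
  have e4 : ∫ y, levyKernel y u ∂(((volume.prod ρ).map fun p : ℝ × ℝ ↦ p.2 • f p.1).restrict {0}ᶜ)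
      = ∫ p, levyKernel (p.2 • f p.1) u ∂(volume.prod ρ) := by
    rw [setIntegral_eq_integral_of_forall_compl_eq_zero, integral_map hgm.aemeasurable
      (Measurable.aestronglyMeasurable (by fun_prop))]
    intro y hy
    have : y = 0 := by simpa using hy
    simp [this, levyKernel]
  have e1 : ∫ s, ((inner ℝ β (inner ℝ (f s) u) : ℝ) : ℂ) * Complex.I
      = (inner ℝ (β • ∫ s, f s) u : ℝ) * Complex.I := by
    rw [integral_mul_const, integral_complex_ofReal, real_inner_smul_left, real_inner_comm,
      ← integral_inner hfi, ← integral_const_mul]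
    simp_rw [hmul, real_inner_comm u]
  have e2 : ∫ s, ((inner ℝ (S (inner ℝ (f s) u)) (inner ℝ (f s) u) : ℝ) : ℂ) / 2
      = ((inner ℝ ((S 1 • ∫ s, InnerProductSpace.rankOne ℝ (f s) (f s)) u) u : ℝ) : ℂ) / 2 := by
    simp_rw [hS1]
    rw [integral_div, integral_complex_ofReal, smul_apply, real_inner_smul_left,
      hRinner, ← integral_const_mul]
    simp_rw [sq]
  rw [e1, e2, e3, e4, inner_add_left]
  push_cast
  ring

end IntegratedExponent

/-! ### The kernel of the Sato process at finitely many times. -/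

section SatoKernel

/-- The value at time `t` of the path `t ↦ e^{-s} 1_{[e^{-s/H}, ∞)}(t)`. -/
def satoKernel (H : ℝ) (t : ℝ≥0) (s : ℝ) : ℝ := jumpPath H s 1 t

lemma jumpPath_eq_mul (H s x : ℝ) (t : ℝ≥0) : jumpPath H s x t = x * satoKernel H t s := by
  simp only [satoKernel, jumpPath]
  ring

lemma satoKernel_zero_left (H s : ℝ) : satoKernel H 0 s = 0 := by
  simp [satoKernel, jumpPath, Real.exp_pos]

/-- The indicator in time `t` of a jump path is the indicator in `s` of the domain of integration
for `X_t`. -/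
lemma exp_neg_div_le_iff {H : ℝ} (hH : 0 < H) {t : ℝ≥0} (ht : 0 < t) (s : ℝ) :
    Real.exp (-s / H) ≤ t ↔ Real.log ((t : ℝ) ^ (-H)) ≤ s := by
  have ht' : (0 : ℝ) < t := by exact_mod_cast ht
  rw [← Real.le_log_iff_exp_le ht', Real.log_rpow ht', div_le_iff₀ hH]
  constructor <;> intro h <;> linarith

lemma satoKernel_of_pos {H : ℝ} (hH : 0 < H) {t : ℝ≥0} (ht : 0 < t) (s : ℝ) :
    satoKernel H t s
      = (Set.Ici (Real.log ((t : ℝ) ^ (-H)))).indicator (fun s ↦ Real.exp (-s)) s := by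
  have h := exp_neg_div_le_iff hH ht s
  simp only [satoKernel, jumpPath, one_mul]
  by_cases hs : Real.log ((t : ℝ) ^ (-H)) ≤ s
  · rw [Set.indicator_of_mem (show (t : ℝ) ∈ Set.Ici _ from h.2 hs),
      Set.indicator_of_mem (show s ∈ Set.Ici _ from hs), Pi.one_apply, mul_one]
  · rw [Set.indicator_of_notMem (show (t : ℝ) ∉ Set.Ici _ from fun h' ↦ hs (h.1 h')),
      Set.indicator_of_notMem (show s ∉ Set.Ici _ from hs), mul_zero]

lemma measurable_satoKernel {H : ℝ} (hH : 0 < H) (t : ℝ≥0) : Measurable (satoKernel H t) := by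
  rcases eq_or_ne t 0 with rfl | ht
  · simp_rw [funext (satoKernel_zero_left H)]
    exact measurable_const
  · rw [funext (satoKernel_of_pos hH (pos_iff_ne_zero.2 ht))]
    exact Measurable.indicator (by fun_prop) measurableSet_Ici

lemma satoKernel_eq_zero_or (H : ℝ) (t : ℝ≥0) (s : ℝ) :
    satoKernel H t s = 0 ∨ satoKernel H t s = Real.exp (-s) := by
  simp only [satoKernel, jumpPath, one_mul]
  by_cases h : (t : ℝ) ∈ Set.Ici (Real.exp (-s / H))
  · right
    rw [Set.indicator_of_mem h, Pi.one_apply, mul_one]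
  · left
    rw [Set.indicator_of_notMem h, mul_zero]

lemma measurable_jumpPath {H : ℝ} (hH : 0 < H) :
    Measurable fun p : ℝ × ℝ ↦ jumpPath H p.1 p.2 := by
  refine measurable_pi_lambda _ fun t ↦ ?_
  simp_rw [jumpPath_eq_mul]
  exact measurable_snd.mul ((measurable_satoKernel hH t).comp measurable_fst)

/-- The vector of the values of the kernel at finitely many times. -/
def satoKernelVec (H : ℝ) (I : Finset ℝ≥0) (s : ℝ) : EuclideanSpace ℝ I :=
  WithLp.toLp 2 fun i : I ↦ satoKernel H i s

lemma measurable_satoKernelVec {H : ℝ} (hH : 0 < H) (I : Finset ℝ≥0) :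
    Measurable (satoKernelVec H I) := by
  have : Measurable fun (s : ℝ) (i : I) ↦ satoKernel H i s :=
    measurable_pi_lambda _ fun i ↦ measurable_satoKernel hH i
  exact (WithLp.measurable_toLp 2 _).comp this

lemma toLp_jumpPath (H : ℝ) (I : Finset ℝ≥0) (s x : ℝ) :
    (WithLp.toLp 2 fun i : I ↦ jumpPath H s x i) = x • satoKernelVec H I s := by
  ext i
  simp [satoKernelVec, jumpPath_eq_mul]

lemma exp_neg_le_norm_satoKernelVec (H : ℝ) (I : Finset ℝ≥0) (s : ℝ)
    (h : satoKernelVec H I s ≠ 0) : Real.exp (-s) ≤ ‖satoKernelVec H I s‖ := by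
  obtain ⟨i, hi⟩ : ∃ i : I, satoKernel H i s ≠ 0 := by
    by_contra! hcon
    exact h (by ext i; exact hcon i)
  have h1 := PiLp.norm_apply_le (satoKernelVec H I s) i
  have h2 : satoKernelVec H I s i = Real.exp (-s) :=
    (satoKernel_eq_zero_or H i s).resolve_left hi
  rwa [h2, Real.norm_of_nonneg (Real.exp_pos _).le] at h1

lemma norm_satoKernelVec_le {H : ℝ} (hH : 0 < H) (I : Finset ℝ≥0) {a : ℝ}
    (ha : ∀ t ∈ I, 0 < t → a ≤ Real.log ((t : ℝ) ^ (-H))) (s : ℝ) :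
    ‖satoKernelVec H I s‖ ≤ (Set.Ici a).indicator (fun s ↦ I.card * Real.exp (-s)) s := by
  by_cases hs : s ∈ Set.Ici a
  · rw [Set.indicator_of_mem hs]
    -- Crude but sufficient: each coordinate is at most `e^{-s}`, and `card ≤ card²` avoids a square
    -- root.
    refine abs_le_of_sq_le_sq' ?_ (by positivity) |>.2
    rw [EuclideanSpace.norm_sq_eq]
    calc ∑ i, ‖satoKernelVec H I s i‖ ^ 2 ≤ ∑ _i : I, Real.exp (-s) ^ 2 := by
          refine Finset.sum_le_sum fun i _ ↦ ?_
          change ‖satoKernel H i s‖ ^ 2 ≤ _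
          rcases satoKernel_eq_zero_or H i s with h | h <;> rw [h]
          · rw [norm_zero, zero_pow two_ne_zero]
            positivity
          · rw [Real.norm_of_nonneg (Real.exp_pos _).le]
      _ = I.card * Real.exp (-s) ^ 2 := by simp
      _ ≤ (I.card * Real.exp (-s)) ^ 2 := by
          rw [mul_pow]
          gcongr
          exact_mod_cast Nat.le_self_pow two_ne_zero I.card
  · rw [Set.indicator_of_notMem hs, norm_le_zero_iff]
    ext i
    change satoKernel H i s = 0
    rcases eq_or_ne (i : ℝ≥0) 0 with h | h
    · rw [h, satoKernel_zero_left]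
    · rw [satoKernel_of_pos hH (pos_iff_ne_zero.2 h), Set.indicator_of_notMem]
      exact fun h' ↦ hs ((ha i i.2 (pos_iff_ne_zero.2 h)).trans h')

/-- `1 ∧ ∑ cᵢ² ≤ ∑ (1 ∧ cᵢ²)` reduces the vector to one time at a time. -/
lemma lintegral_satoKernelVec_lt_top {H : ℝ} (I : Finset ℝ≥0) {ρ : Measure ℝ}
    [SFinite ρ] (hH : 0 < H)
    (h : ∀ t ∈ I, 0 < t → ∫⁻ p, ENNReal.ofReal (min 1 ((p.2 * Real.exp (-p.1)) ^ 2))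
      ∂((volume.restrict (Set.Ici (Real.log ((t : ℝ) ^ (-H))))).prod ρ) < ∞) :
    ∫⁻ p : ℝ × ℝ, ENNReal.ofReal (min 1 (‖p.2 • satoKernelVec H I p.1‖ ^ 2))
      ∂(volume.prod ρ) < ∞ := by
  have hm (t : ℝ≥0) := measurable_satoKernel hH t
  have hone (t : ℝ≥0) (ht : t ∈ I) :
      ∫⁻ p : ℝ × ℝ, ENNReal.ofReal (min 1 ((p.2 * satoKernel H t p.1) ^ 2))
        ∂(volume.prod ρ) < ∞ := by
    rcases eq_or_ne t 0 with rfl | ht0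
    · simp [satoKernel_zero_left]
    · have htpos := pos_iff_ne_zero.2 ht0
      have h1 := h t ht htpos
      rw [← Measure.restrict_univ (μ := ρ), Measure.prod_restrict,
        ← lintegral_indicator (measurableSet_Ici.prod MeasurableSet.univ)] at h1
      refine lt_of_le_of_lt (le_of_eq (lintegral_congr fun p ↦ ?_)) h1
      rw [satoKernel_of_pos hH htpos]
      by_cases hs : p.1 ∈ Set.Ici (Real.log ((t : ℝ) ^ (-H)))
      · rw [Set.indicator_of_mem hs, Set.indicator_of_mem
          (show p ∈ Set.Ici (Real.log ((t : ℝ) ^ (-H))) ×ˢ Set.univ from ⟨hs, Set.mem_univ _⟩)]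
      · rw [Set.indicator_of_notMem hs, Set.indicator_of_notMem
          (show p ∉ Set.Ici (Real.log ((t : ℝ) ^ (-H))) ×ˢ Set.univ from fun h' ↦ hs h'.1)]
        simp
  refine lt_of_le_of_lt (b := ∑ i : I,
    ∫⁻ p : ℝ × ℝ, ENNReal.ofReal (min 1 ((p.2 * satoKernel H i p.1) ^ 2)) ∂(volume.prod ρ)) ?_ ?_
  · rw [← lintegral_finsetSum _ (fun i _ ↦ by
      have := hm i
      fun_prop)]
    refine lintegral_mono fun p ↦ ?_
    rw [← ENNReal.ofReal_sum_of_nonneg fun i _ ↦ by positivity]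
    refine ENNReal.ofReal_le_ofReal ?_
    rw [EuclideanSpace.norm_sq_eq]
    have hcoord (i : I) : ‖(p.2 • satoKernelVec H I p.1) i‖ ^ 2
        = (p.2 * satoKernel H i p.1) ^ 2 := by
      rw [Real.norm_eq_abs, sq_abs]
      rfl
    simp_rw [hcoord]
    by_cases hex : ∃ i : I, 1 ≤ (p.2 * satoKernel H i p.1) ^ 2
    · obtain ⟨i, hi⟩ := hex
      refine (min_le_left _ _).trans ?_
      have := Finset.single_le_sum (s := Finset.univ)
        (f := fun i : I ↦ min 1 ((p.2 * satoKernel H i p.1) ^ 2)) (fun j _ ↦ by positivity)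
        (Finset.mem_univ i)
      simp only [min_eq_left hi] at this
      exact this
    · push Not at hex
      refine (min_le_right _ _).trans (Finset.sum_le_sum fun i _ ↦ ?_)
      rw [min_eq_right (hex i).le]
  · exact ENNReal.sum_lt_top.2 fun i _ ↦ hone i i.2

end SatoKernel

/-! ### Finite-dimensional laws of the Sato process and its Lévy measure. -/

section SatoProcess

variable {Ω : Type*} [MeasurableSpace Ω] {P : Measure Ω} {Y : ℝ → Ω → ℝ} {H : ℝ}
  {X : ℝ≥0 → Ω → ℝ}

lemma ae_eq_zero_of_satoProcess (hX : ∀ t, X t =ᵐ[P] satoProcess Y H t) :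
    ∀ᵐ ω ∂P, X 0 ω = 0 := by
  filter_upwards [hX 0] with ω hω
  rw [hω, satoProcess, if_pos rfl]

variable [IsProbabilityMeasure P]

lemma ae_tendsto_pathIntegral_satoProcess (hY : IsTwoSidedLevyProcess P Y)
    (hlog : Integrable (fun ω ↦ Real.posLog |Y 1 ω|) P)
    (hX : ∀ t, X t =ᵐ[P] satoProcess Y H t) {t : ℝ≥0} (ht : 0 < t) :
    ∀ᵐ ω ∂P, Tendsto (fun b : ℝ ↦ pathIntegral (fun s ↦ Real.exp (-s)) (fun s ↦ Y s ω)
      (Real.log ((t : ℝ) ^ (-H))) b) atTop (𝓝 (X t ω)) := by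
  filter_upwards [hY.cadlag, hY.ae_exists_abs_le_exp_half hlog, hX t] with ω hcad ⟨C, K, hC⟩ hXt
  obtain ⟨l, hl⟩ := exists_tendsto_pathIntegral hcad hC (Real.log ((t : ℝ) ^ (-H)))
  rw [hXt, satoProcess, if_neg ht.ne', hl.limUnder_eq]
  exact hl

/-- The finite-dimensional marginals of the Sato process are given by the exponent of the driving
Lévy process, integrated along the kernel. -/
lemma charFun_satoProcess (hY : IsTwoSidedLevyProcess P Y)
    (hlog : Integrable (fun ω ↦ Real.posLog |Y 1 ω|) P) (hH : 0 < H)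
    (hX : ∀ t, X t =ᵐ[P] satoProcess Y H t) {ψ : ℝ → ℂ} (hψ : Continuous ψ) (hψ0 : ψ 0 = 0)
    (h1 : ∀ u, charFun (P.map (Y 1)) u = Complex.exp (ψ u)) (I : Finset ℝ≥0)
    (u : EuclideanSpace ℝ I)
    (hint : Integrable fun s ↦ ψ (inner ℝ (satoKernelVec H I s) u)) :
    charFun (P.map fun ω ↦ (WithLp.toLp 2 fun i : I ↦ X i ω : EuclideanSpace ℝ I)) u
      = Complex.exp (∫ s, ψ (inner ℝ (satoKernelVec H I s) u)) := by
  classical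
  let a (i : I) : ℝ := Real.log ((i : ℝ) ^ (-H))
  obtain ⟨M, hM⟩ : ∃ M, ∀ i, a i ≤ M := by
    obtain ⟨M, hM⟩ := (Finset.univ.image a).bddAbove
    exact ⟨M, fun i ↦ hM (by simp)⟩
  have haM (m : ℕ) (i : I) : a i ≤ M + m := (hM i).trans (by linarith [m.cast_nonneg (α := ℝ)])
  -- All coordinates share the upper limit `M + m`. Time `0` is set apart, since `Real.log (0 ^
  -- (-H))` is `0` by convention instead of `+∞`.
  let V (m : ℕ) (ω : Ω) : EuclideanSpace ℝ I := WithLp.toLp 2 fun i : I ↦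
    if (i : ℝ≥0) = 0 then 0
    else pathIntegral (fun s ↦ Real.exp (-s)) (fun s ↦ Y s ω) (a i) (M + m)
  have hVm (m : ℕ) : AEMeasurable (V m) P := by
    refine (WithLp.measurable_toLp 2 _).comp_aemeasurable (aemeasurable_pi_iff.2 fun i ↦ ?_)
    split_ifs
    · exact aemeasurable_const
    · exact hY.aemeasurable_pathIntegral (haM m i)
  have hb : Tendsto (fun m : ℕ ↦ M + (m : ℝ)) atTop atTop :=
    tendsto_atTop_add_const_left _ M tendsto_natCast_atTop_atTop
  have hVlim : ∀ᵐ ω ∂P, Tendsto (fun m ↦ V m ω) atTop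
      (𝓝 (WithLp.toLp 2 fun i : I ↦ X i ω : EuclideanSpace ℝ I)) := by
    have hall : ∀ᵐ ω ∂P, ∀ i : I, (i : ℝ≥0) ≠ 0 → Tendsto (fun b : ℝ ↦
        pathIntegral (fun s ↦ Real.exp (-s)) (fun s ↦ Y s ω) (a i) b) atTop (𝓝 (X i ω)) := by
      refine ae_all_iff.2 fun i ↦ ?_
      by_cases hi : (i : ℝ≥0) = 0
      · exact Eventually.of_forall fun ω h ↦ absurd hi h
      · filter_upwards [ae_tendsto_pathIntegral_satoProcess hY hlog hX (pos_iff_ne_zero.2 hi)]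
          with ω hω _ using hω
    filter_upwards [hall, ae_eq_zero_of_satoProcess hX] with ω hω h0
    refine ((PiLp.continuous_toLp 2 _).tendsto _).comp (tendsto_pi_nhds.2 fun i ↦ ?_)
    by_cases hi : (i : ℝ≥0) = 0
    · simp only [hi, if_true, h0]
      exact tendsto_const_nhds
    · simp only [hi, if_false]
      exact (hω i hi).comp hb
  have hlim := tendsto_charFun_map_of_ae_tendsto hVm hVlim u
  have hker (m : ℕ) (s : ℝ) : ∑ i ∈ Finset.univ.filter (fun i : I ↦ (i : ℝ≥0) ≠ 0),
      u i * (Set.Ico (a i) (M + m)).indicator (fun s ↦ Real.exp (-s)) s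
      = (Set.Iio (M + (m : ℝ))).indicator (fun s ↦ inner ℝ (satoKernelVec H I s) u) s := by
    rw [Finset.sum_filter]
    have hinner : inner ℝ (satoKernelVec H I s) u = ∑ i : I, u i * satoKernel H i s := by
      rw [PiLp.inner_apply]
      refine Finset.sum_congr rfl fun i _ ↦ ?_
      simp only [RCLike.inner_apply, conj_trivial]
      rfl
    by_cases hs : s ∈ Set.Iio (M + (m : ℝ))
    · rw [Set.indicator_of_mem hs, hinner]
      refine Finset.sum_congr rfl fun i _ ↦ ?_
      by_cases hi : (i : ℝ≥0) = 0
      · rw [if_neg (not_not.2 hi), hi, satoKernel_zero_left, mul_zero]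
      · rw [if_pos hi, satoKernel_of_pos hH (pos_iff_ne_zero.2 hi)]
        congr 1
        by_cases hs' : a i ≤ s
        · rw [Set.indicator_of_mem (show s ∈ Set.Ico _ _ from ⟨hs', hs⟩),
            Set.indicator_of_mem (show s ∈ Set.Ici _ from hs')]
        · rw [Set.indicator_of_notMem (show s ∉ Set.Ico _ _ from fun h ↦ hs' h.1),
            Set.indicator_of_notMem (show s ∉ Set.Ici _ from hs')]
    · rw [Set.indicator_of_notMem hs]
      refine Finset.sum_eq_zero fun i _ ↦ ?_
      rw [Set.indicator_of_notMem (show s ∉ Set.Ico _ _ from fun h ↦ hs h.2), mul_zero, ite_self]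
  have hVcf (m : ℕ) : charFun (P.map (V m)) u = Complex.exp
      (∫ s, (Set.Iio (M + (m : ℝ))).indicator (fun s ↦ ψ (inner ℝ (satoKernelVec H I s) u)) s) := by
    have h2 := hY.charFun_sum_pathIntegral hψ hψ0 h1
      (Finset.univ.filter (fun i : I ↦ (i : ℝ≥0) ≠ 0)) a (fun i ↦ u i) (fun i _ ↦ haM m i)
    simp_rw [hker m] at h2
    have h3 (s : ℝ) : ψ ((Set.Iio (M + (m : ℝ))).indicator
        (fun s ↦ inner ℝ (satoKernelVec H I s) u) s)
        = (Set.Iio (M + (m : ℝ))).indicator (fun s ↦ ψ (inner ℝ (satoKernelVec H I s) u)) s := by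
      by_cases hs : s ∈ Set.Iio (M + (m : ℝ)) <;> simp [hs, hψ0]
    simp_rw [h3] at h2
    rw [← h2, charFun_apply, charFun_apply, integral_map (hVm m)
      (Continuous.aestronglyMeasurable (by fun_prop)), integral_map
      (Finset.aemeasurable_fun_sum _ fun i _ ↦
        (hY.aemeasurable_pathIntegral (haM m i)).const_mul _)
      (Continuous.aestronglyMeasurable (by fun_prop))]
    refine integral_congr_ae (Eventually.of_forall fun ω ↦ ?_)
    have hinner : inner ℝ (V m ω) u
        = ∑ i ∈ Finset.univ.filter (fun i : I ↦ (i : ℝ≥0) ≠ 0),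
          u i * pathIntegral (fun s ↦ Real.exp (-s)) (fun s ↦ Y s ω) (a i) (M + m) := by
      rw [PiLp.inner_apply, Finset.sum_filter]
      refine Finset.sum_congr rfl fun i _ ↦ ?_
      simp only [RCLike.inner_apply, conj_trivial, V]
      by_cases hi : (i : ℝ≥0) = 0 <;> simp [hi]
    simp only [hinner]
    congr 3
    simp
  simp_rw [hVcf] at hlim
  refine tendsto_nhds_unique hlim ((Complex.continuous_exp.tendsto _).comp ?_)
  -- The cut-off exponents are dominated by the full one, integrable by `hint`.
  refine tendsto_integral_of_dominated_convergence _ (fun m ↦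
    hint.aestronglyMeasurable.indicator measurableSet_Iio) hint.norm
    (fun m ↦ Eventually.of_forall fun s ↦ norm_indicator_le_norm_self _ _)
    (Eventually.of_forall fun s ↦ tendsto_const_nhds.congr' ?_)
  filter_upwards [hb.eventually_gt_atTop s] with m hm
  rw [Set.indicator_of_mem (show s ∈ Set.Iio _ from hm)]

/-- The image of `ds ⊗ ρ` under `(s, x) ↦ x e^{-s} 1_{[e^{-s/H}, ∞)}` is a Lévy measure of the
Sato process. -/
theorem isProcessLevyMeasure_map_jumpPath (hY : IsTwoSidedLevyProcess P Y)
    (hlog : Integrable (fun ω ↦ Real.posLog |Y 1 ω|) P) (hH : 0 < H)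
    (hX : ∀ t, X t =ᵐ[P] satoProcess Y H t) {ρ : Measure ℝ}
    (hρ : IsLevyMeasure (P.map (Y 1)) ρ) :
    IsProcessLevyMeasure P X
      (((volume : Measure ℝ).prod ρ).map fun p : ℝ × ℝ ↦ jumpPath H p.1 p.2) := by
  obtain ⟨β, S, hS, h1⟩ := hρ.exists_levyExponent
  have := sigmaFinite_of_lintegral_min_lt_top hρ.1 hρ.2.1
  have hjm := measurable_jumpPath hH
  refine ⟨fun I ↦ ?_, fun A hA ↦ ?_⟩
  · have hmap : (((volume : Measure ℝ).prod ρ).map fun p : ℝ × ℝ ↦ jumpPath H p.1 p.2).map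
        (fun f ↦ (WithLp.toLp 2 fun i : I ↦ f i : EuclideanSpace ℝ I))
        = (volume.prod ρ).map fun p : ℝ × ℝ ↦ p.2 • satoKernelVec H I p.1 := by
      rw [Measure.map_map (measurable_toLp_restrict I) hjm]
      congr 1
      ext1 p
      exact toLp_jumpPath H I p.1 p.2
    rw [hmap]
    have hgm : Measurable fun p : ℝ × ℝ ↦ p.2 • satoKernelVec H I p.1 :=
      measurable_snd.smul ((measurable_satoKernelVec hH I).comp measurable_fst)
    have hJ := lintegral_satoKernelVec_lt_top (H := H) I (ρ := ρ) hH fun t _ ht ↦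
      hY.lintegral_min_one_sq_lt_top hρ.2.1 hS h1
        (ae_tendsto_pathIntegral_satoProcess hY hlog hX ht)
    obtain ⟨a, ha⟩ : ∃ a : ℝ, ∀ t ∈ I, 0 < t → a ≤ Real.log ((t : ℝ) ^ (-H)) := by
      obtain ⟨a, ha⟩ := (I.image fun t : ℝ≥0 ↦ Real.log ((t : ℝ) ^ (-H))).bddBelow
      exact ⟨a, fun t ht _ ↦ ha (by exact Finset.mem_coe.2 (Finset.mem_image_of_mem _ ht))⟩
    obtain ⟨b, T, hT, hbT⟩ := exists_integral_levyExponent_inner hρ.2.1 β hS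
      (measurable_satoKernelVec hH I) (Nat.cast_nonneg I.card) (norm_satoKernelVec_le hH I ha)
      (exp_neg_le_norm_satoKernelVec H I) hJ
    refine ⟨?_, ?_, b, T, hT, fun u ↦ ?_⟩
    · rw [Measure.restrict_apply (measurableSet_singleton 0)]
      simp
    · refine (setLIntegral_le_lintegral _ _).trans_lt ?_
      rwa [lintegral_map (by fun_prop) hgm]
    · rw [charFun_satoProcess hY hlog hH hX (continuous_levyExponent hρ.2.1 β S)
        (levyExponent_zero β S ρ) h1 I u (hbT u).1, (hbT u).2]
      rfl
  · set ν := ((volume : Measure ℝ).prod ρ).map fun p : ℝ × ℝ ↦ jumpPath H p.1 p.2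
    -- `N` misses the zero path and is conull: if `x ≠ 0`, the jump path is nonzero at any integer
    -- `n ≥ e^{-s/H}`, and `x = 0` is `ρ`-null. So `A ∩ N` attains the supremum in condition (ii).
    let N : Set (ℝ≥0 → ℝ) := ⋃ n : ℕ, {f | f n ≠ 0}
    have hN : MeasurableSet N := MeasurableSet.iUnion fun n ↦
      (measurableSet_eq_fun (measurable_pi_apply _) measurable_const).compl
    have hN0 : ν Nᶜ = 0 := by
      rw [Measure.map_apply hjm hN.compl]
      refine measure_mono_null (t := Set.univ ×ˢ {0}) (fun p hp ↦ ?_) ?_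
      · refine ⟨Set.mem_univ _, ?_⟩
        by_contra hx
        refine hp ?_
        obtain ⟨n, hn⟩ := exists_nat_ge (Real.exp (-p.1 / H))
        refine Set.mem_iUnion.2 ⟨n, ?_⟩
        change jumpPath H p.1 p.2 n ≠ 0
        rw [jumpPath, Set.indicator_of_mem (by simpa using hn), Pi.one_apply, mul_one]
        exact mul_ne_zero hx (Real.exp_pos _).ne'
      · rw [Measure.prod_prod, hρ.1, mul_zero]
    refine le_antisymm ?_ (iSup_le fun B ↦ iSup_le fun _ ↦ iSup_le fun hB ↦
      measure_mono (hB.trans Set.sdiff_subset))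
    rw [← measure_inter_conull hN0]
    refine le_iSup_of_le (A ∩ N) (le_iSup_of_le (hA.inter hN) (le_iSup_of_le ?_ le_rfl))
    rintro f ⟨hfA, hfN⟩
    refine ⟨hfA, fun hf0 ↦ ?_⟩
    obtain ⟨n, hn⟩ := Set.mem_iUnion.1 hfN
    rw [Set.mem_singleton_iff] at hf0
    exact hn (by rw [hf0]; rfl)

end SatoProcess

end

theorem mainTheorem3 {Ω : Type*} [MeasurableSpace Ω] (P : Measure Ω) [IsProbabilityMeasure P]
    (Y : ℝ → Ω → ℝ) (hY : IsTwoSidedLevyProcess P Y)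
    (hlog : Integrable (fun ω ↦ Real.posLog |Y 1 ω|) P)
    (H : ℝ) (hH : 0 < H)
    (X : ℝ≥0 → Ω → ℝ) (hX : ∀ t, X t =ᵐ[P] satoProcess Y H t)
    (ρ : Measure ℝ) (hρ : IsLevyMeasure (P.map (Y 1)) ρ) :
    -- the improper integrals defining `X` converge almost surely
    (∀ t : ℝ≥0, 0 < t → ∀ᵐ ω ∂P, Tendsto
      (fun b : ℝ ↦ pathIntegral (fun s ↦ Real.exp (-s)) (fun s ↦ Y s ω)
        (Real.log ((t : ℝ) ^ (-H))) b) atTop (𝓝 (X t ω))) ∧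
    -- `X` has exactly one Lévy measure `ν`, and `ν` is as claimed
    ∃ ν : Measure (ℝ≥0 → ℝ),
      IsProcessLevyMeasure P X ν ∧
      (∀ ν' : Measure (ℝ≥0 → ℝ), IsProcessLevyMeasure P X ν' → ν' = ν) ∧
      (∀ F : (ℝ≥0 → ℝ) → ℝ≥0∞, Measurable F →
        ∫⁻ f, F f ∂ν = ∫⁻ s : ℝ, ∫⁻ x : ℝ, F (jumpPath H s x) ∂ρ) ∧
      ν = ((volume : Measure ℝ).prod ρ).map (fun p : ℝ × ℝ ↦ jumpPath H p.1 p.2) := by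
  have hν := isProcessLevyMeasure_map_jumpPath hY hlog hH hX hρ
  refine ⟨fun t ht ↦ ae_tendsto_pathIntegral_satoProcess hY hlog hX ht, _, hν,
    fun ν' hν' ↦ hν'.unique hν, fun F hF ↦ ?_, rfl⟩
  have := sigmaFinite_of_lintegral_min_lt_top hρ.1 hρ.2.1
  have hjm := measurable_jumpPath hH
  rw [lintegral_map hF hjm]
  exact lintegral_prod _ (hF.comp hjm).aemeasurable
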